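/- Let $G=\mathbb R/2\pi\mathbb Z$ be the unit circle, $G_-=(0,\frac\pi2)$, $G_+=(\frac\pi2,2\pi)$, and write $W_\pm=W|_{G_\pm}$, so that $L^2(G)=L^2(G_-)\times L^2(G_+)$ (complex-valued functions). Let $a_-,a_+$ be non-zero complex constants (for instance real ones with $a_-a_+<0$). Let $$\hat E=\Bigl\{W\in H^1(G)\;:\; W_-\in H^2(G_-),\ W_+\in H^2(G_+),\ a_+W_+'(2\pi)-a_-W_-'(0)=0,\ a_+W_+'(\tfrac\pi2)-a_-W_-'(\tfrac\pi2)=0\Bigr\},$$ with the norm of $H^2(G_-)\times H^2(G_+)$, and for $\lambda\in\mathbb C$ let $$\mathcal L(\lambda):\hat E\to L^2(G),\qquad W\mapsto\bigl(a_-(\lambda^2+\partial_\theta^2)W_-,\;a_+(\lambda^2+\partial_\theta^2)W_+\bigr).$$ Let $\mathfrak S(\mathcal L)$ be the spectrum of $\mathcal L$, i.e. the set of $\lambda\in\mathbb C$ for which $\mathcal L(\lambda)$ is not bijective. Then $\lambda\mapsto\mathcal L(\lambda)^{-1}$ is a meromorphic function on $\mathbb C$ with values in the space of bounded operators $L^2(G)\to\hat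 E$: every point of $\mathbb C$ has a punctured neighbourhood disjoint from $\mathfrak S(\mathcal L)$; for $\lambda\notin\mathfrak S(\mathcal L)$ the inverse $\mathcal L(\lambda)^{-1}$ is bounded, and it depends holomorphically on $\lambda\in\mathbb C\setminus\mathfrak S(\mathcal L)$; and $\mathcal L(\lambda)^{-1}$ is meromorphic at every point of $\mathbb C$. Moreover its polar parts are of finite rank: near every $\lambda_0\in\mathbb C$ one has $\mathcal L(\lambda)^{-1}=\sum_{k=1}^{N}(\lambda-\lambda_0)^{-k}A_k+g(\lambda)$, with bounded finite-rank operators $A_1,\dots,A_N:L^2(G)\to\hat E$ and $g$ holomorphic at $\lambda_0$. The set of its poles is exactly $\mathfrak S(\mathcal L)$. -/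

import Mathlib

open MeasureTheory Set Filter Topology
open scoped ContDiff

noncomputable section

namespace MellinTransmission

/-- Lebesgue measure on the open interval `(a, b)`. -/
abbrev intervalMeasure (a b : ℝ) : Measure ℝ := volume.restrict (Ioo a b)

/-- The complex Hilbert space `L²(a, b)`. -/
abbrev L2 (a b : ℝ) : Type := Lp ℂ 2 (intervalMeasure a b)

lemma integrable_mul_continuous {a b : ℝ} (u : L2 a b) {φ : ℝ → ℂ} (hφ : Continuous φ) :
    Integrable (fun t => u t * φ t) (intervalMeasure a b) := by
  have : IsFiniteMeasure (intervalMeasure a b) :=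
    ⟨by rw [intervalMeasure, Measure.restrict_apply_univ]; simp⟩
  have hu : Integrable (fun t => u t) (intervalMeasure a b) :=
    (Lp.memLp u).integrable (by norm_num)
  obtain ⟨C, hC⟩ := (isCompact_Icc (a := a) (b := b)).exists_bound_of_continuousOn hφ.continuousOn
  refine hu.mul_bdd (c := C) hφ.aestronglyMeasurable ?_
  filter_upwards [ae_restrict_mem (measurableSet_Ioo (a := a) (b := b))] with t ht
  exact hC t (Ioo_subset_Icc_self ht)

lemma integral_add_mul {a b : ℝ} (u v : L2 a b) {φ : ℝ → ℂ} (hφ : Continuous φ) :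
    ∫ t in Ioo a b, (u + v) t * φ t = (∫ t in Ioo a b, u t * φ t) + ∫ t in Ioo a b, v t * φ t := by
  rw [← integral_add (integrable_mul_continuous u hφ) (integrable_mul_continuous v hφ)]
  refine integral_congr_ae ?_
  filter_upwards [Lp.coeFn_add u v] with t ht
  rw [ht, Pi.add_apply, add_mul]

lemma integral_smul_mul {a b : ℝ} (c : ℂ) (u : L2 a b) (φ : ℝ → ℂ) :
    ∫ t in Ioo a b, (c • u) t * φ t = c * ∫ t in Ioo a b, u t * φ t := by
  rw [← integral_const_mul]
  refine integral_congr_ae ?_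
  filter_upwards [Lp.coeFn_smul c u] with t ht
  rw [ht, Pi.smul_apply, smul_eq_mul, mul_assoc]

lemma integral_zero_mul {a b : ℝ} (φ : ℝ → ℂ) :
    ∫ t in Ioo a b, (0 : L2 a b) t * φ t = 0 := by
  simpa using integral_smul_mul (0 : ℂ) (0 : L2 a b) φ

/-- `v` is the weak derivative of `u` on `(a, b)`: `∫ u φ' = - ∫ v φ` for every test function
`φ ∈ C_c^∞((a, b))`. -/
def IsWeakDeriv {a b : ℝ} (u v : L2 a b) : Prop :=
  ∀ φ : ℝ → ℂ, ContDiff ℝ ∞ φ → HasCompactSupport φ → tsupport φ ⊆ Ioo a b →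
    ∫ t in Ioo a b, u t * deriv φ t = - ∫ t in Ioo a b, v t * φ t

lemma IsWeakDeriv.add {a b : ℝ} {u v u' v' : L2 a b} (h : IsWeakDeriv u v)
    (h' : IsWeakDeriv u' v') : IsWeakDeriv (u + u') (v + v') := by
  intro φ h1 h2 h3
  rw [integral_add_mul _ _ (h1.continuous_deriv (by simp)), integral_add_mul _ _ h1.continuous,
    h φ h1 h2 h3, h' φ h1 h2 h3]
  ring

lemma IsWeakDeriv.smul {a b : ℝ} {u v : L2 a b} (c : ℂ) (h : IsWeakDeriv u v) :
    IsWeakDeriv (c • u) (c • v) := by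
  intro φ h1 h2 h3
  rw [integral_smul_mul, integral_smul_mul, h φ h1 h2 h3]
  ring

lemma IsWeakDeriv.zero {a b : ℝ} : IsWeakDeriv (0 : L2 a b) 0 := by
  intro φ _ _ _
  rw [integral_zero_mul, integral_zero_mul, neg_zero]

/-- The Sobolev space `H²(a, b)`. A function `u` is stored together with its weak derivatives, as
the triple `(u, u', u'')` of elements of `L²(a, b)`, so that the norm inherited from `L²(a, b)³` is
the `H²` norm `(‖u‖² + ‖u'‖² + ‖u''‖²)^{1/2}`. The weak derivatives are determined by `u`. -/
def SobolevH2 (a b : ℝ) : Submodule ℂ (PiLp 2 (fun _ : Fin 3 => L2 a b)) where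
  carrier := {u | IsWeakDeriv (u 0) (u 1) ∧ IsWeakDeriv (u 1) (u 2)}
  add_mem' := fun h h' => ⟨h.1.add h'.1, h.2.add h'.2⟩
  zero_mem' := ⟨IsWeakDeriv.zero, IsWeakDeriv.zero⟩
  smul_mem' := fun c _ h => ⟨h.1.smul c, h.2.smul c⟩

/-- The bounded operator `∂^k : H²(a, b) → L²(a, b)`, `k = 0, 1, 2`. -/
def derivL (a b : ℝ) (k : Fin 3) : SobolevH2 a b →L[ℂ] L2 a b :=
  (PiLp.proj 2 (fun _ : Fin 3 => L2 a b) k).comp (SobolevH2 a b).subtypeL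

/-- `f` is a representative of `u` that is continuous on the closed interval `[a, b]`. For `a < b`,
the values of `f` on `[a, b]` are determined by `u`, and `f a`, `f b` are the traces of `u` at the
end points. Every element of `H¹(a, b)` has such a representative. -/
def IsContRep {a b : ℝ} (u : L2 a b) (f : ℝ → ℂ) : Prop :=
  ContinuousOn f (Icc a b) ∧ u =ᵐ[intervalMeasure a b] f

lemma IsContRep.add {a b : ℝ} {u v : L2 a b} {f g : ℝ → ℂ} (h : IsContRep u f)
    (h' : IsContRep v g) : IsContRep (u + v) (f + g) :=
  ⟨h.1.add h'.1, (Lp.coeFn_add u v).trans (h.2.add h'.2)⟩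

lemma IsContRep.smul {a b : ℝ} {u : L2 a b} {f : ℝ → ℂ} (c : ℂ) (h : IsContRep u f) :
    IsContRep (c • u) (c • f) :=
  ⟨h.1.const_smul c, (Lp.coeFn_smul c u).trans (h.2.const_smul c)⟩

lemma IsContRep.zero {a b : ℝ} : IsContRep (0 : L2 a b) 0 :=
  ⟨continuousOn_const, Lp.coeFn_zero _ _ _⟩

/-- The arcs `G₋ = (0, π/2)` and `G₊ = (π/2, 2π)` of the unit circle `G = ℝ/2πℤ`. They cover `G` up
to two points, and `L²(G) = L²(G₋) × L²(G₊)` isometrically. -/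
abbrev L2Circle : Type := WithLp 2 (L2 0 (Real.pi / 2) × L2 (Real.pi / 2) (2 * Real.pi))

instance : NormedAddCommGroup L2Circle := WithLp.instProdNormedAddCommGroup 2 _ _

instance : NormedSpace ℂ L2Circle := WithLp.instProdNormedSpace 2 ℂ _ _

/-- `W = (W₋, W₊) ∈ L²(G)` belongs to `H¹(G)`, where `G = ℝ/2πℤ`: there is `V ∈ L²(G)` with
`∫_G W φ' = - ∫_G V φ` for every smooth `φ` on the circle, that is, every smooth `2π`-periodic
function `φ`. -/
def MemH1Circle (W : L2Circle) : Prop :=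
  ∃ V : L2Circle, ∀ φ : ℝ → ℂ, ContDiff ℝ ∞ φ → Function.Periodic φ (2 * Real.pi) →
    (∫ t in Ioo 0 (Real.pi / 2), W.fst t * deriv φ t) +
        (∫ t in Ioo (Real.pi / 2) (2 * Real.pi), W.snd t * deriv φ t) =
      - ((∫ t in Ioo 0 (Real.pi / 2), V.fst t * φ t) +
        ∫ t in Ioo (Real.pi / 2) (2 * Real.pi), V.snd t * φ t)

lemma MemH1Circle.add {W W' : L2Circle} (h : MemH1Circle W) (h' : MemH1Circle W') :
    MemH1Circle (W + W') := by
  obtain ⟨V, hV⟩ := h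
  obtain ⟨V', hV'⟩ := h'
  refine ⟨V + V', fun φ h1 h2 => ?_⟩
  have hd := h1.continuous_deriv (by simp)
  have e := hV φ h1 h2
  have e' := hV' φ h1 h2
  rw [WithLp.add_fst, WithLp.add_snd, WithLp.add_fst, WithLp.add_snd, integral_add_mul _ _ hd,
    integral_add_mul _ _ hd, integral_add_mul _ _ h1.continuous, integral_add_mul _ _ h1.continuous]
  linear_combination e + e'

lemma MemH1Circle.smul {W : L2Circle} (c : ℂ) (h : MemH1Circle W) : MemH1Circle (c • W) := by
  obtain ⟨V, hV⟩ := h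
  refine ⟨c • V, fun φ h1 h2 => ?_⟩
  have e := hV φ h1 h2
  rw [WithLp.smul_fst, WithLp.smul_snd, WithLp.smul_fst, WithLp.smul_snd, integral_smul_mul,
    integral_smul_mul, integral_smul_mul, integral_smul_mul]
  linear_combination c * e

/-- The Hilbert space `H²(G₋) × H²(G₊)`. -/
abbrev H2Pieces : Type :=
  WithLp 2 (SobolevH2 0 (Real.pi / 2) × SobolevH2 (Real.pi / 2) (2 * Real.pi))

/-- `W ↦ (∂^k W₋, ∂^k W₊)`, from `H²(G₋) × H²(G₊)` to `L²(G)`, scaled by a constant on each arc. -/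
def piecewiseDeriv (cMinus cPlus : ℂ) (k : Fin 3) : H2Pieces →L[ℂ] L2Circle :=
  ((WithLp.prodContinuousLinearEquiv 2 ℂ (L2 0 (Real.pi / 2))
      (L2 (Real.pi / 2) (2 * Real.pi))).symm : _ →L[ℂ] L2Circle).comp
    ((cMinus • (derivL 0 (Real.pi / 2) k).comp (WithLp.fstL 2 ℂ _ _)).prod
      (cPlus • (derivL (Real.pi / 2) (2 * Real.pi) k).comp (WithLp.sndL 2 ℂ _ _)))

/-- The conditions `aPlus W₊' - aMinus W₋' = 0` at the two points of `∂G₋ ∩ ∂G₊`: the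
point `0 = 2π` and the point `π/2` of the circle. -/
def Transmission (aMinus aPlus : ℂ) (W : H2Pieces) : Prop :=
  ∃ fMinus fPlus : ℝ → ℂ,
    IsContRep (derivL _ _ 1 W.fst) fMinus ∧ IsContRep (derivL _ _ 1 W.snd) fPlus ∧
    aPlus * fPlus (2 * Real.pi) - aMinus * fMinus 0 = 0 ∧
    aPlus * fPlus (Real.pi / 2) - aMinus * fMinus (Real.pi / 2) = 0

/-- The subspace `Ê` of `H²(G₋) × H²(G₊)`: the `W ∈ H¹(G)` with `(W₋, W₊) ∈ H²(G₋) × H²(G₊)` that satisfy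
the transmission conditions. -/
def EHatSubmodule (aMinus aPlus : ℂ) : Submodule ℂ H2Pieces where
  carrier := {W | MemH1Circle (piecewiseDeriv 1 1 0 W) ∧ Transmission aMinus aPlus W}
  add_mem' := by
    rintro W W' ⟨h, f, g, hf, hg, e1, e2⟩ ⟨h', f', g', hf', hg', e1', e2'⟩
    refine ⟨?_, f + f', g + g', ?_, ?_, ?_, ?_⟩
    · rw [map_add]
      exact h.add h'
    · rw [WithLp.add_fst, map_add]
      exact hf.add hf'
    · rw [WithLp.add_snd, map_add]
      exact hg.add hg'
    · simp only [Pi.add_apply]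
      linear_combination e1 + e1'
    · simp only [Pi.add_apply]
      linear_combination e2 + e2'
  zero_mem' := by
    refine ⟨?_, 0, 0, ?_, ?_, by simp, by simp⟩
    · refine ⟨0, fun φ _ _ => ?_⟩
      rw [map_zero, WithLp.zero_fst, WithLp.zero_snd]
      simp only [integral_zero_mul, add_zero, neg_zero]
    · rw [WithLp.zero_fst, map_zero]
      exact IsContRep.zero
    · rw [WithLp.zero_snd, map_zero]
      exact IsContRep.zero
  smul_mem' := by
    rintro c W ⟨h, f, g, hf, hg, e1, e2⟩
    refine ⟨?_, c • f, c • g, ?_, ?_, ?_, ?_⟩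
    · rw [map_smul]
      exact h.smul c
    · rw [WithLp.smul_fst, map_smul]
      exact hf.smul c
    · rw [WithLp.smul_snd, map_smul]
      exact hg.smul c
    · simp only [Pi.smul_apply, smul_eq_mul]
      linear_combination c * e1
    · simp only [Pi.smul_apply, smul_eq_mul]
      linear_combination c * e2

/-- The Hilbert space `Ê`, with the norm of `H²(G₋) × H²(G₊)`. -/
def EHat (aMinus aPlus : ℂ) : Type := EHatSubmodule aMinus aPlus

instance (aMinus aPlus : ℂ) : NormedAddCommGroup (EHat aMinus aPlus) :=
  inferInstanceAs (NormedAddCommGroup (EHatSubmodule aMinus aPlus))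

instance (aMinus aPlus : ℂ) : NormedSpace ℂ (EHat aMinus aPlus) :=
  inferInstanceAs (NormedSpace ℂ (EHatSubmodule aMinus aPlus))

/-- The inclusion of `Ê` in `H²(G₋) × H²(G₊)`. -/
def EHat.incl (aMinus aPlus : ℂ) : EHat aMinus aPlus →L[ℂ] H2Pieces :=
  (EHatSubmodule aMinus aPlus).subtypeL

/-- The Mellin symbol `L(z) : Ê → L²(G)`,
`W ↦ (aMinus (z² + ∂²) W₋, aPlus (z² + ∂²) W₊)`. -/
def symbol (aMinus aPlus : ℂ) (z : ℂ) : EHat aMinus aPlus →L[ℂ] L2Circle :=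
  (z ^ 2 • piecewiseDeriv aMinus aPlus 0 + piecewiseDeriv aMinus aPlus 2).comp
    (EHat.incl aMinus aPlus)

/-- The spectrum of the symbol: the `z` for which `L(z)` is not bijective. -/
def symbolSpectrum (aMinus aPlus : ℂ) : Set ℂ :=
  {z | ¬ Function.Bijective (symbol aMinus aPlus z)}

/-- `z ↦ L(z)⁻¹`, with the junk value `0` where `L(z)` has no bounded inverse. -/
def symbolInverse (aMinus aPlus : ℂ) (z : ℂ) : L2Circle →L[ℂ] EHat aMinus aPlus :=
  (symbol aMinus aPlus z).inverse

/-- The function `R` has near `z₀` a Laurent expansion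
`R(z) = ∑_{k < N} (z - z₀)^{-(k+1)} A_k + g(z)`, with `g` holomorphic at `z₀` and finitely many
coefficients `A_k` in the polar part, all of them operators of finite rank. -/
def HasFiniteRankPolarPartAt {E F : Type*} [NormedAddCommGroup E] [NormedSpace ℂ E]
    [NormedAddCommGroup F] [NormedSpace ℂ F] (R : ℂ → E →L[ℂ] F) (z₀ : ℂ) : Prop :=
  ∃ (N : ℕ) (A : Fin N → E →L[ℂ] F) (g : ℂ → E →L[ℂ] F),
    (∀ k, FiniteDimensional ℂ (LinearMap.range (A k : E →ₗ[ℂ] F))) ∧ AnalyticAt ℂ g z₀ ∧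
      ∀ᶠ z in 𝓝[≠] z₀, R z = ∑ k : Fin N, ((z - z₀) ^ ((k : ℕ) + 1))⁻¹ • A k + g z

end MellinTransmission

end

/-!
The space `Ê` is the null space of the four jump functionals `B` (values and weighted derivatives
at the two common end points of the arcs) on `X = H²(G₋) × H²(G₊)`, and the symbol `L(z)` is the
restriction to `Ê` of the operator `M(z)`, `W ↦ (a₋ (z² + ∂²) W₋, a₊ (z² + ∂²) W₊)`, on all of `X`
(`mem_EHatSubmodule_iff`). The pair of `M(z)` and the Cauchy data `C` at the left end points of the
arcs is an isomorphism `X ≃ L²(G) × ℂ⁴` for every `z`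
(`isInvertible_fullSymbol_prod_cauchyData`): this is the solvability of the Cauchy problem, which
follows from the factorization `z² + ∂² = (∂ + iz)(∂ - iz)` and the variation of constants formula
for equations of first order. Its inverse is therefore an entire operator family.

Write `T(z)` for the solution operator with `C W = 0` and `N(z) : ℂ⁴ → X` for the parametrization of
the null space of `M(z)` by its Cauchy data. Then `L(z)` is invertible as soon as the matrix
`B N(z)` is, and `L(z)⁻¹ = T - N (B N)⁻¹ B T`. By Cramer's rule the singularities of the second term
are those of `1 / det (B N)` times an analytic family that factors through `ℂ⁴`, and the Taylor
coefficients of such a family are of finite rank (`exists_finiteRank_taylor`). This gives the polar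
parts, provided that the entire function `det (B N)` does not vanish identically
(`eventually_bijective_and_hasFiniteRankPolarPartAt`). At `z = 2/3` it does not vanish, whatever the
constants: solutions change sign across the arc of length `3π/2`, and those satisfying the matching
conditions would have to do the same across the arc of length `π/2`, which is impossible
(`eq_zero_of_fullSymbol_two_thirds`).

Finally, at a point of the spectrum the inverse has a pole, since otherwise its limit would invert
the symbol there (`meromorphicOrderAt_inverse_neg_iff`).

The description of `Ê` by bounded functionals uses that an element of `H¹(a, b)` is the primitive of
its weak derivative (a consequence of the lemma of du Bois-Reymond,
`ae_eq_const_of_integral_mul_deriv_eq_zero`), and that `W ∈ H¹(G)` forces the one-sided values to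
agree (`memH1Circle_iff`): a jump would be a point mass represented by a square integrable function.
-/

noncomputable section

namespace MellinTransmission

/-! ### Polar parts of operator families -/

lemma _root_.AnalyticAt.dslope_self {F : Type*} [NormedAddCommGroup F] [NormedSpace ℂ F]
    {f : ℂ → F} {z₀ : ℂ} (hf : AnalyticAt ℂ f z₀) : AnalyticAt ℂ (dslope f z₀) z₀ := by
  obtain ⟨p, hp⟩ := hf
  exact ⟨_, hp.has_fpower_series_dslope_fslope⟩

lemma _root_.AnalyticAt.clm_comp {E F G : Type*} [NormedAddCommGroup E] [NormedSpace ℂ E]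
    [NormedAddCommGroup F] [NormedSpace ℂ F] [NormedAddCommGroup G] [NormedSpace ℂ G]
    {f : ℂ → F →L[ℂ] G} {g : ℂ → E →L[ℂ] F} {z₀ : ℂ} (hf : AnalyticAt ℂ f z₀)
    (hg : AnalyticAt ℂ g z₀) : AnalyticAt ℂ (fun z => (f z).comp (g z)) z₀ :=
  AnalyticAt.comp₂ ((ContinuousLinearMap.compL ℂ E F G).analyticAt_bilinear _) hf hg

section PolarPart

variable {E F Y : Type*} [NormedAddCommGroup E] [NormedSpace ℂ E] [NormedAddCommGroup F]
  [NormedSpace ℂ F] [NormedAddCommGroup Y] [NormedSpace ℂ Y] {z₀ : ℂ}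

lemma finiteDimensional_range_comp [FiniteDimensional ℂ Y] (K : Y →L[ℂ] F) (J : E →L[ℂ] Y) :
    FiniteDimensional ℂ (LinearMap.range (K.comp J : E →ₗ[ℂ] F)) := by
  rw [ContinuousLinearMap.toLinearMap_comp, LinearMap.range_comp]
  infer_instance

lemma finiteDimensional_range_add {A B : E →L[ℂ] F}
    (hA : FiniteDimensional ℂ (LinearMap.range (A : E →ₗ[ℂ] F)))
    (hB : FiniteDimensional ℂ (LinearMap.range (B : E →ₗ[ℂ] F))) :
    FiniteDimensional ℂ (LinearMap.range ((A + B : E →L[ℂ] F) : E →ₗ[ℂ] F)) := by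
  refine Submodule.finiteDimensional_of_le (S₂ := LinearMap.range (A : E →ₗ[ℂ] F) ⊔
    LinearMap.range (B : E →ₗ[ℂ] F)) ?_
  rintro _ ⟨x, rfl⟩
  exact Submodule.add_mem_sup ⟨x, rfl⟩ ⟨x, rfl⟩

/-- The Taylor coefficients of a product `K(z) J(z)` of analytic operator families that factors
through a finite-dimensional space are of finite rank: the coefficients of `K J` are sums of
products of coefficients of `K` and `J`. -/
lemma exists_finiteRank_taylor [FiniteDimensional ℂ Y] (n : ℕ) :
    ∀ (K : ℂ → Y →L[ℂ] F) (J : ℂ → E →L[ℂ] Y), AnalyticAt ℂ K z₀ → AnalyticAt ℂ J z₀ →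
      ∃ (c : ℕ → E →L[ℂ] F) (g : ℂ → E →L[ℂ] F),
        (∀ k, FiniteDimensional ℂ (LinearMap.range (c k : E →ₗ[ℂ] F))) ∧ AnalyticAt ℂ g z₀ ∧
        ∀ z, (K z).comp (J z) =
          ∑ k ∈ Finset.range n, (z - z₀) ^ k • c k + (z - z₀) ^ n • g z := by
  induction n with
  | zero =>
    intro K J hK hJ
    refine ⟨fun _ => (K z₀).comp (J z₀), fun z => (K z).comp (J z),
      fun _ => finiteDimensional_range_comp _ _, hK.clm_comp hJ, fun z => by simp⟩
  | succ n ih =>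
    intro K J hK hJ
    obtain ⟨c, g, hc, hg, e⟩ := ih (fun _ => K z₀) (dslope J z₀) analyticAt_const hJ.dslope_self
    obtain ⟨c', g', hc', hg', e'⟩ := ih (dslope K z₀) J hK.dslope_self hJ
    -- Peel off the constant terms: `K J = K(z₀) J(z₀) + (z - z₀) (K(z₀) J₁ + K₁ J)`, where `J₁`
    -- and `K₁` are the difference quotients.
    refine ⟨fun k => Nat.casesOn k ((K z₀).comp (J z₀)) fun k => c k + c' k, fun z => g z + g' z,
      ?_, hg.add hg', fun z => ?_⟩
    · rintro (_ | k)
      · exact finiteDimensional_range_comp _ _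
      · exact finiteDimensional_range_add (hc k) (hc' k)
    · have hK' : K z = K z₀ + (z - z₀) • dslope K z₀ z := by rw [sub_smul_dslope]; abel
      have hJ' : J z = J z₀ + (z - z₀) • dslope J z₀ z := by rw [sub_smul_dslope]; abel
      have key : (K z).comp (J z) = (K z₀).comp (J z₀) +
          (z - z₀) • ((K z₀).comp (dslope J z₀ z) + (dslope K z₀ z).comp (J z)) := by
        calc (K z).comp (J z) = (K z₀).comp (J z) + (z - z₀) • (dslope K z₀ z).comp (J z) := by
              conv_lhs => rw [hK']
              rw [ContinuousLinearMap.add_comp, ContinuousLinearMap.smul_comp]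
          _ = _ := by
              conv_lhs => enter [1]; rw [hJ']
              rw [ContinuousLinearMap.comp_add, ContinuousLinearMap.comp_smul, smul_add, add_assoc]
      rw [key, e, e', Finset.sum_range_succ']
      simp only [pow_zero, one_smul, smul_add, Finset.sum_add_distrib, Finset.smul_sum, pow_succ',
        mul_smul, Nat.rec_zero]
      generalize z - z₀ = w
      abel

/-- If `R = g + d⁻¹ K J` near `z₀`, with analytic `g`, `K`, `J`, `d`, where `K J` factors through a
finite-dimensional space and `d` does not vanish identically near `z₀`, then the polar part of `R`
at `z₀` is finite and of finite rank. -/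
lemma hasFiniteRankPolarPartAt_of_eventuallyEq [FiniteDimensional ℂ Y] {R g : ℂ → E →L[ℂ] F}
    {K : ℂ → Y →L[ℂ] F} {J : ℂ → E →L[ℂ] Y} {d : ℂ → ℂ} (hg : AnalyticAt ℂ g z₀)
    (hK : AnalyticAt ℂ K z₀) (hJ : AnalyticAt ℂ J z₀) (hd : AnalyticAt ℂ d z₀)
    (hd0 : ∀ᶠ z in 𝓝[≠] z₀, d z ≠ 0)
    (hR : ∀ᶠ z in 𝓝[≠] z₀, R z = g z + (d z)⁻¹ • (K z).comp (J z)) :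
    HasFiniteRankPolarPartAt R z₀ := by
  have hnt : ¬ ∀ᶠ z in 𝓝 z₀, d z = 0 := fun h =>
    ((h.filter_mono nhdsWithin_le_nhds).and hd0).exists.elim fun _ hz => hz.2 hz.1
  obtain ⟨n, e, he, he0, hde⟩ := hd.exists_eventuallyEq_pow_smul_nonzero_iff.mpr hnt
  obtain ⟨c, h, hc, hh, hch⟩ := exists_finiteRank_taylor n (fun z => (e z)⁻¹ • K z) J
    ((he.inv he0).smul hK) hJ
  refine ⟨n, fun k => c (n - 1 - k), fun z => g z + h z, fun k => hc _, hg.add hh, ?_⟩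
  filter_upwards [hR, hde.filter_mono nhdsWithin_le_nhds, self_mem_nhdsWithin] with z h1 h2 h3
  have hz : z - z₀ ≠ 0 := sub_ne_zero.mpr h3
  have h4 : (d z)⁻¹ • (K z).comp (J z) =
      ((z - z₀) ^ n)⁻¹ • ((e z)⁻¹ • K z).comp (J z) := by
    rw [h2, ContinuousLinearMap.smul_comp, smul_smul, smul_eq_mul, mul_inv]
  rw [h1, h4, hch z, smul_add, inv_smul_smul₀ (pow_ne_zero _ hz),
    Fin.sum_univ_eq_sum_range (fun k => ((z - z₀) ^ (k + 1))⁻¹ • c (n - 1 - k)) n,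
    Finset.smul_sum]
  have : ∑ k ∈ Finset.range n, ((z - z₀) ^ n)⁻¹ • (z - z₀) ^ k • c k =
      ∑ j ∈ Finset.range n, ((z - z₀) ^ (n - 1 - j + 1))⁻¹ • c (n - 1 - (n - 1 - j)) := by
    refine Finset.sum_congr rfl fun k hk => ?_
    have hk := Finset.mem_range.mp hk
    rw [show n - 1 - (n - 1 - k) = k by omega, smul_smul]
    congr 1
    rw [inv_mul_eq_iff_eq_mul₀ (pow_ne_zero _ hz), ← div_eq_mul_inv,
      eq_div_iff (pow_ne_zero _ hz), ← pow_add]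
    congr 1
    omega
  rw [this, Finset.sum_range_reflect (fun k => ((z - z₀) ^ (k + 1))⁻¹ • c (n - 1 - k)) n]
  abel

lemma HasFiniteRankPolarPartAt.meromorphicAt {R : ℂ → E →L[ℂ] F}
    (h : HasFiniteRankPolarPartAt R z₀) : MeromorphicAt R z₀ := by
  obtain ⟨N, A, g, -, hg, hR⟩ := h
  have h1 : MeromorphicAt (fun z => ∑ k : Fin N, ((z - z₀) ^ ((k : ℕ) + 1))⁻¹ • A k + g z) z₀ := by
    refine MeromorphicAt.add (MeromorphicAt.fun_sum fun k _ => ?_) hg.meromorphicAt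
    fun_prop
  exact h1.congr (hR.mono fun z hz => hz.symm)

end PolarPart

/-! ### Inverses of analytic operator families -/

section Inverse

variable {E F : Type*} [NormedAddCommGroup E] [NormedSpace ℂ E] [NormedAddCommGroup F]
  [NormedSpace ℂ F] [CompleteSpace E]

lemma analyticAt_inverse {S : ℂ → E →L[ℂ] F} {z₀ : ℂ} (hS : AnalyticAt ℂ S z₀)
    (h : (S z₀).IsInvertible) : AnalyticAt ℂ (fun z => (S z).inverse) z₀ := by
  have := (h.contDiffAt_map_inverse (n := ω)).analyticAt
  exact this.fun_comp hS

lemma isInvertible_of_bijective [CompleteSpace F] {S : E →L[ℂ] F} (h : Function.Bijective S) :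
    S.IsInvertible :=
  ⟨ContinuousLinearEquiv.ofBijective S (LinearMap.ker_eq_bot.mpr h.1)
    (LinearMap.range_eq_top.mpr h.2), ContinuousLinearMap.ext fun _ => rfl⟩

/-- Where the inverse of an analytic operator family has no pole, the family is invertible: the
limit of the inverses is a two-sided inverse of the limit. -/
lemma meromorphicOrderAt_inverse_neg_iff {S : ℂ → E →L[ℂ] F} {z₀ : ℂ}
    (hS : AnalyticAt ℂ S z₀) (hinv : ∀ᶠ z in 𝓝[≠] z₀, (S z).IsInvertible)
    (hm : MeromorphicAt (fun z => (S z).inverse) z₀) :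
    meromorphicOrderAt (fun z => (S z).inverse) z₀ < 0 ↔ ¬ (S z₀).IsInvertible := by
  rw [← not_le, not_iff_not]
  refine ⟨fun h => ?_, fun h => (analyticAt_inverse hS h).meromorphicOrderAt_nonneg⟩
  obtain ⟨T, hT⟩ := (tendsto_nhds_iff_meromorphicOrderAt_nonneg hm).mpr h
  have hS' : Tendsto S (𝓝[≠] z₀) (𝓝 (S z₀)) := hS.continuousAt.tendsto.mono_left nhdsWithin_le_nhds
  refine ContinuousLinearMap.IsInvertible.of_inverse (g := T) ?_ ?_
  · refine tendsto_nhds_unique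
      ((isBoundedBilinearMap_comp.continuous.tendsto (S z₀, T)).comp (hS'.prodMk_nhds hT))
      (tendsto_const_nhds.congr' ?_)
    filter_upwards [hinv] with z hz using hz.self_comp_inverse.symm
  · refine tendsto_nhds_unique
      ((isBoundedBilinearMap_comp.continuous.tendsto (T, S z₀)).comp (hT.prodMk_nhds hS'))
      (tendsto_const_nhds.congr' ?_)
    filter_upwards [hinv] with z hz using hz.inverse_comp_self.symm

end Inverse

/-- Cramer's rule for an analytic family of endomorphisms of `ℂ^ι`: the determinant `d` and the
adjugate `K` are analytic as well. -/
lemma exists_analytic_adjugate {ι : Type*} [Fintype ι] [DecidableEq ι]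
    {D : ℂ → (ι → ℂ) →L[ℂ] (ι → ℂ)} (hD : ∀ z, AnalyticAt ℂ D z) :
    ∃ (d : ℂ → ℂ) (K : ℂ → (ι → ℂ) →L[ℂ] (ι → ℂ)), (∀ z, AnalyticAt ℂ d z) ∧
      (∀ z, AnalyticAt ℂ K z) ∧ (∀ z c, D z (K z c) = d z • c) ∧ (∀ z c, K z (D z c) = d z • c) ∧
      ∀ z, Function.Injective (D z) → d z ≠ 0 := by
  let m : ℂ → Matrix ι ι ℂ := fun z => LinearMap.toMatrix' (D z : (ι → ℂ) →ₗ[ℂ] ι → ℂ)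
  have hmv : ∀ z c, (m z).mulVec c = D z c := fun z c => LinearMap.toMatrix'_mulVec _ c
  have hm : ∀ i j z, AnalyticAt ℂ (fun z => m z i j) z := by
    intro i j z
    have h1 : AnalyticAt ℂ (fun z => D z (Pi.single j 1)) z :=
      ((ContinuousLinearMap.apply ℂ (ι → ℂ) (Pi.single j 1 : ι → ℂ)).analyticAt _).fun_comp (hD z)
    have h2 := ((ContinuousLinearMap.proj (R := ℂ) (φ := fun _ : ι => ℂ) i).analyticAt
      _).fun_comp h1
    refine h2.congr (Eventually.of_forall fun w => ?_)
    simp only [m, LinearMap.toMatrix'_apply]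
    rfl
  have hdet : ∀ (M : ℂ → Matrix ι ι ℂ), (∀ i j z, AnalyticAt ℂ (fun z => M z i j) z) →
      ∀ z, AnalyticAt ℂ (fun z => (M z).det) z := by
    intro M hM z
    simp only [Matrix.det_apply']
    exact Finset.analyticAt_fun_sum _ fun σ _ => analyticAt_const.mul
      (Finset.analyticAt_fun_prod _ fun i _ => hM _ _ z)
  have hadj : ∀ i j z, AnalyticAt ℂ (fun z => (m z).adjugate i j) z := by
    intro i j z
    simp only [Matrix.adjugate_apply]
    refine hdet _ (fun k l w => ?_) z
    by_cases hk : k = j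
    · subst hk
      simpa using analyticAt_const
    · simpa [Matrix.updateRow_ne hk] using hm k l w
  let e : ι → ι → (ι → ℂ) →L[ℂ] (ι → ℂ) := fun i j =>
    (ContinuousLinearMap.single ℂ (fun _ : ι => ℂ) i).comp (ContinuousLinearMap.proj j)
  have hK : ∀ z c, (∑ i, ∑ j, (m z).adjugate i j • e i j) c = (m z).adjugate.mulVec c := by
    intro z c
    ext k
    simp [e, Matrix.mulVec, dotProduct, Finset.sum_apply,
      Pi.single_apply]
  refine ⟨fun z => (m z).det, fun z => ∑ i, ∑ j, (m z).adjugate i j • e i j, hdet m hm, fun z => ?_,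
    fun z c => ?_, fun z c => ?_, fun z hz h0 => ?_⟩
  · exact Finset.analyticAt_fun_sum _ fun i _ => Finset.analyticAt_fun_sum _ fun j _ =>
      (hadj i j z).smul analyticAt_const
  · rw [hK, ← hmv, Matrix.mulVec_mulVec, Matrix.mul_adjugate, Matrix.smul_mulVec, Matrix.one_mulVec]
  · rw [hK, ← hmv, Matrix.mulVec_mulVec, Matrix.adjugate_mul, Matrix.smul_mulVec, Matrix.one_mulVec]
  · obtain ⟨c, hc, hc0⟩ := Matrix.exists_mulVec_eq_zero_iff.mpr h0
    exact hc (hz (by rw [← hmv, hc0, map_zero]))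

/-- Let `A(z) = (M(z), C) : X → H × ℂ^ι` be invertible for all `z` and let `S(z)` be the restriction
of the analytic family `M(z)` to the null space of another operator `B : X → ℂ^ι`. If `B` is
injective on the null space of `M(z₁)` for one `z₁`, then `S(z)` is bijective outside a discrete set
and its inverse has finite polar parts of finite rank. -/
theorem eventually_bijective_and_hasFiniteRankPolarPartAt {X H ι : Type*} [NormedAddCommGroup X]
    [NormedSpace ℂ X] [CompleteSpace X] [NormedAddCommGroup H] [NormedSpace ℂ H] [Fintype ι]
    {M : ℂ → X →L[ℂ] H} (hM : ∀ z, AnalyticAt ℂ M z)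
    {B C : X →L[ℂ] (ι → ℂ)} (hA : ∀ z, ((M z).prod C).IsInvertible) {p : Submodule ℂ X}
    (hp : ∀ W, W ∈ p ↔ B W = 0) {z₁ : ℂ} (hz₁ : ∀ W, M z₁ W = 0 → B W = 0 → W = 0) (z₀ : ℂ) :
    (∀ᶠ z in 𝓝[≠] z₀, Function.Bijective ((M z).comp p.subtypeL)) ∧
      HasFiniteRankPolarPartAt (fun z => ((M z).comp p.subtypeL).inverse) z₀ := by
  classical
  have hAan : ∀ z, AnalyticAt ℂ (fun z => ((M z).prod C).inverse) z := by
    intro z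
    refine analyticAt_inverse ?_ (hA z)
    have h1 : AnalyticAt ℂ (fun z => (ContinuousLinearMap.inl ℂ H (ι → ℂ)).comp (M z) +
        (ContinuousLinearMap.inr ℂ H (ι → ℂ)).comp C) z :=
      (analyticAt_const.clm_comp (hM z)).add analyticAt_const
    refine h1.congr (Eventually.of_forall fun w => ?_)
    ext x <;> simp
  -- `T` solves the problem with homogeneous data `C W = 0`, `N` parametrizes the null space of `M`.
  let T : ℂ → H →L[ℂ] X := fun z =>
    ((M z).prod C).inverse.comp (ContinuousLinearMap.inl ℂ H (ι → ℂ))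
  let N : ℂ → (ι → ℂ) →L[ℂ] X := fun z =>
    ((M z).prod C).inverse.comp (ContinuousLinearMap.inr ℂ H (ι → ℂ))
  have hT : ∀ z, AnalyticAt ℂ T z := fun z => (hAan z).clm_comp analyticAt_const
  have hN : ∀ z, AnalyticAt ℂ N z := fun z => (hAan z).clm_comp analyticAt_const
  have hMT : ∀ z f, M z (T z f) = f := fun z f =>
    congrArg Prod.fst ((hA z).self_apply_inverse (f, 0))
  have hMN : ∀ z c, M z (N z c) = 0 := fun z c =>
    congrArg Prod.fst ((hA z).self_apply_inverse (0, c))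
  have hCN : ∀ z c, C (N z c) = c := fun z c =>
    congrArg Prod.snd ((hA z).self_apply_inverse (0, c))
  have hNC : ∀ z W, M z W = 0 → N z (C W) = W := by
    intro z W hW
    have h1 := (hA z).inverse_apply_self W
    rwa [ContinuousLinearMap.prod_apply, hW] at h1
  obtain ⟨d, K, hd, hK, hDK, hKD, hdi⟩ := exists_analytic_adjugate
    (D := fun z => B.comp (N z)) fun z => analyticAt_const.clm_comp (hN z)
  simp only [ContinuousLinearMap.comp_apply] at hDK hKD
  have hd₁ : d z₁ ≠ 0 := by
    refine hdi z₁ ((injective_iff_map_eq_zero _).mpr fun c hc => ?_)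
    rw [← hCN z₁ c, hz₁ _ (hMN z₁ c) hc, map_zero]
  have hd0 : ∀ᶠ z in 𝓝[≠] z₀, d z ≠ 0 := by
    by_contra h
    rw [← Filter.not_frequently, not_not] at h
    exact hd₁ (AnalyticOnNhd.eqOn_zero_of_preconnected_of_frequently_eq_zero
      (fun z _ => hd z) isPreconnected_univ (mem_univ z₀) h (mem_univ z₁))
  -- A bounded projection of `X` onto the null space of `B`.
  let π : X →L[ℂ] p := (ContinuousLinearMap.id ℂ X -
    ((d z₁)⁻¹ • (N z₁).comp (K z₁)).comp B).codRestrict p fun W => by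
      rw [hp]
      simp [hDK, smul_smul, inv_mul_cancel₀ hd₁]
  have hπ : ∀ W, B W = 0 → (π W : X) = W := by
    intro W hW
    simp [π, hW]
  let R : ℂ → H →L[ℂ] p := fun z => π.comp (T z) +
    (d z)⁻¹ • (-(π.comp ((N z).comp (K z)))).comp (B.comp (T z))
  have hR : ∀ z, d z ≠ 0 → ((M z).comp p.subtypeL).comp (R z) = ContinuousLinearMap.id ℂ H := by
    intro z hz
    ext f
    have h1 : R z f = π (T z f - (d z)⁻¹ • N z (K z (B (T z f)))) := by
      simp [R, sub_eq_add_neg]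
    have h2 : B (T z f - (d z)⁻¹ • N z (K z (B (T z f)))) = 0 := by
      rw [map_sub, map_smul, hDK, inv_smul_smul₀ hz, sub_self]
    rw [ContinuousLinearMap.comp_apply, ContinuousLinearMap.comp_apply, h1,
      Submodule.subtypeL_apply, hπ _ h2, map_sub, map_smul, hMT, hMN, smul_zero, sub_zero,
      ContinuousLinearMap.id_apply]
  have hinj : ∀ z, d z ≠ 0 → Function.Injective ((M z).comp p.subtypeL) := by
    intro z hz
    refine (injective_iff_map_eq_zero _).mpr fun w hw => ?_
    have h1 : M z (w : X) = 0 := hw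
    have h2 := hKD z (C (w : X))
    rw [hNC z _ h1, (hp _).mp w.2, map_zero] at h2
    have h3 : C (w : X) = 0 := by simpa [hz] using h2.symm
    have h4 := hNC z _ h1
    rw [h3, map_zero] at h4
    exact Subtype.ext h4.symm
  have hinv : ∀ z, d z ≠ 0 → ((M z).comp p.subtypeL).inverse = R z ∧
      Function.Bijective ((M z).comp p.subtypeL) := by
    intro z hz
    have h1 := hR z hz
    have h2 : (R z).comp ((M z).comp p.subtypeL) = ContinuousLinearMap.id ℂ p := by
      ext1 w
      refine hinj z hz ?_
      exact DFunLike.congr_fun h1 ((M z).comp p.subtypeL w)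
    have h3 := ContinuousLinearMap.IsInvertible.of_inverse h1 h2
    refine ⟨?_, h3.bijective⟩
    ext1 f
    rw [h3.inverse_apply_eq]
    exact (DFunLike.congr_fun h1 f).symm
  refine ⟨hd0.mono fun z hz => (hinv z hz).2, ?_⟩
  refine hasFiniteRankPolarPartAt_of_eventuallyEq (g := fun z => π.comp (T z))
    (K := fun z => -(π.comp ((N z).comp (K z)))) (J := fun z => B.comp (T z)) (d := d)
    (analyticAt_const.clm_comp (hT z₀))
    (analyticAt_const.clm_comp ((hN z₀).clm_comp (hK z₀))).neg
    (analyticAt_const.clm_comp (hT z₀)) (hd z₀) hd0 (hd0.mono fun z hz => (hinv z hz).1)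

/-! ### Primitives and weak derivatives on an interval -/

instance (a b : ℝ) : IsFiniteMeasure (intervalMeasure a b) :=
  ⟨by rw [intervalMeasure, Measure.restrict_apply_univ]; simp⟩

lemma memLp_of_continuousOn_Icc {a b : ℝ} {f : ℝ → ℂ} (hf : ContinuousOn f (Icc a b)) :
    MemLp f 2 (intervalMeasure a b) := by
  obtain ⟨C, hC⟩ := (isCompact_Icc (a := a) (b := b)).exists_bound_of_continuousOn hf
  refine MemLp.of_bound ((hf.mono Ioo_subset_Icc_self).aestronglyMeasurable measurableSet_Ioo) C ?_
  filter_upwards [ae_restrict_mem (measurableSet_Ioo (a := a) (b := b))] with t ht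
  exact hC t (Ioo_subset_Icc_self ht)

lemma integrable_coeFn {a b : ℝ} (u : L2 a b) : Integrable (fun t => u t) (intervalMeasure a b) :=
  (Lp.memLp u).integrable (by norm_num)

/-- Integration against a continuous function, as a bounded functional on `L²(a, b)`. -/
def pairing {a b : ℝ} (φ : ℝ → ℂ) (hφ : Continuous φ) : L2 a b →L[ℂ] ℂ :=
  innerSL ℂ ((memLp_of_continuousOn_Icc (a := a) (b := b)
    (Complex.continuous_conj.comp hφ).continuousOn).toLp : L2 a b)

lemma pairing_apply {a b : ℝ} {φ : ℝ → ℂ} (hφ : Continuous φ) (u : L2 a b) :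
    pairing φ hφ u = ∫ t in Ioo a b, u t * φ t := by
  rw [pairing, innerSL_apply_apply, L2.inner_def]
  refine integral_congr_ae ?_
  filter_upwards [(memLp_of_continuousOn_Icc (a := a) (b := b)
    (Complex.continuous_conj.comp hφ).continuousOn).coeFn_toLp] with t ht
  rw [ht]
  simp

/-- Integration by parts for the primitive of an integrable function, from Fubini's theorem. -/
lemma integral_zero_primitive_mul_deriv {a b : ℝ} {g φ : ℝ → ℂ}
    (hg : Integrable g (intervalMeasure a b)) (hφ : ContDiff ℝ 1 φ) :
    ∫ t in Ioo a b, (∫ s in a..t, g s) * deriv φ t =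
      (∫ t in Ioo a b, g t) * φ b - ∫ t in Ioo a b, g t * φ t := by
  have hφ' : Continuous (deriv φ) := hφ.continuous_deriv le_rfl
  have hφ'i : Integrable (deriv φ) (intervalMeasure a b) :=
    (memLp_of_continuousOn_Icc hφ'.continuousOn).integrable (by norm_num)
  have hφi : Integrable φ (intervalMeasure a b) :=
    (memLp_of_continuousOn_Icc hφ.continuous.continuousOn).integrable (by norm_num)
  have hgφ : Integrable (fun t => g t * φ t) (intervalMeasure a b) := by
    obtain ⟨C, hC⟩ := (isCompact_Icc (a := a) (b := b)).exists_bound_of_continuousOn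
      hφ.continuous.continuousOn
    refine hg.mul_bdd (c := C) hφ.continuous.aestronglyMeasurable ?_
    filter_upwards [ae_restrict_mem (measurableSet_Ioo (a := a) (b := b))] with t ht
    exact hC t (Ioo_subset_Icc_self ht)
  -- The kernel `g(s) φ'(t)` on the triangle `s < t`.
  let k : ℝ → ℝ → ℂ := fun t s => {p : ℝ × ℝ | p.1 < p.2}.indicator
    (fun p => g p.1 * deriv φ p.2) (s, t)
  have hk : Integrable (Function.uncurry k) ((intervalMeasure a b).prod (intervalMeasure a b)) :=
    ((hg.mul_prod hφ'i).indicator (measurableSet_lt measurable_fst measurable_snd)).swap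
  have hl : ∀ t ∈ Ioo a b, ∫ s in Ioo a b, k t s = (∫ s in a..t, g s) * deriv φ t := by
    intro t ht
    have h1 : ∀ s, k t s = (Iio t).indicator (fun s => g s * deriv φ t) s := fun s => rfl
    simp_rw [h1]
    rw [setIntegral_indicator measurableSet_Iio, Ioo_inter_Iio, min_eq_right ht.2.le,
      integral_mul_const, intervalIntegral.integral_of_le ht.1.le, integral_Ioc_eq_integral_Ioo]
  have hr : ∀ s ∈ Ioo a b, ∫ t in Ioo a b, k t s = g s * (φ b - φ s) := by
    intro s hs
    have h1 : ∀ t, k t s = (Ioi s).indicator (fun t => g s * deriv φ t) t := fun t => rfl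
    simp_rw [h1]
    rw [setIntegral_indicator measurableSet_Ioi, Ioo_inter_Ioi, max_eq_right hs.1.le,
      integral_const_mul, ← integral_Ioc_eq_integral_Ioo,
      ← intervalIntegral.integral_of_le hs.2.le, intervalIntegral.integral_deriv_eq_sub'
        _ rfl (fun x _ => (hφ.differentiable one_ne_zero).differentiableAt) hφ'.continuousOn]
  rw [← setIntegral_congr_fun measurableSet_Ioo hl, integral_integral_swap hk,
    setIntegral_congr_fun measurableSet_Ioo hr]
  simp_rw [mul_sub]
  rw [integral_sub (hg.mul_const _) hgφ, integral_mul_const]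

lemma apply_eq_zero_of_tsupport_subset_Ioo {a b : ℝ} {φ : ℝ → ℂ} (h : tsupport φ ⊆ Ioo a b) :
    φ a = 0 ∧ φ b = 0 :=
  ⟨image_eq_zero_of_notMem_tsupport fun ha => lt_irrefl _ (h ha).1,
    image_eq_zero_of_notMem_tsupport fun hb => lt_irrefl _ (h hb).2⟩

lemma integral_Ioo_deriv {a b : ℝ} (hab : a ≤ b) {φ : ℝ → ℂ} (hφ : ContDiff ℝ 1 φ) :
    ∫ t in Ioo a b, deriv φ t = φ b - φ a := by
  rw [← integral_Ioc_eq_integral_Ioo, ← intervalIntegral.integral_of_le hab,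
    intervalIntegral.integral_deriv_eq_sub' _ rfl
      (fun x _ => (hφ.differentiable one_ne_zero).differentiableAt)
      (hφ.continuous_deriv le_rfl).continuousOn]

/-- The primitive of `g` with value `c` at `a`. -/
def primitive (a : ℝ) (c : ℂ) (g : ℝ → ℂ) (t : ℝ) : ℂ := c + ∫ s in a..t, g s

lemma primitive_left (a : ℝ) (c : ℂ) (g : ℝ → ℂ) : primitive a c g a = c := by simp [primitive]

lemma continuousOn_primitive {a b : ℝ} (c : ℂ) {g : ℝ → ℂ}
    (hg : Integrable g (intervalMeasure a b)) : ContinuousOn (primitive a c g) (Icc a b) := by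
  have h1 : IntegrableOn g (Icc a b) := by rwa [integrableOn_Icc_iff_integrableOn_Ioo]
  exact continuousOn_const.add (intervalIntegral.continuousOn_primitive h1 |>.congr fun t ht => by
    rw [intervalIntegral.integral_of_le ht.1])

lemma integral_primitive_mul_deriv {a b : ℝ} (hab : a ≤ b) (c : ℂ) {g φ : ℝ → ℂ}
    (hg : Integrable g (intervalMeasure a b)) (hφ : ContDiff ℝ 1 φ) :
    (∫ t in Ioo a b, primitive a c g t * deriv φ t) =
      primitive a c g b * φ b - primitive a c g a * φ a - ∫ t in Ioo a b, g t * φ t := by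
  have hφ' : Continuous (deriv φ) := hφ.continuous_deriv le_rfl
  have h1 : Integrable (fun t => c * deriv φ t) (intervalMeasure a b) :=
    ((memLp_of_continuousOn_Icc hφ'.continuousOn).integrable (by norm_num)).const_mul c
  have h2 : Integrable (fun t => (∫ s in a..t, g s) * deriv φ t) (intervalMeasure a b) := by
    have := ((memLp_of_continuousOn_Icc ((continuousOn_primitive 0 hg).mul
      hφ'.continuousOn)).integrable (by norm_num))
    exact this.congr (Eventually.of_forall fun t => by simp [primitive])
  simp only [primitive, add_mul]
  rw [integral_add h1 h2, integral_const_mul, integral_Ioo_deriv hab hφ,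
    integral_zero_primitive_mul_deriv hg hφ, intervalIntegral.integral_same,
    intervalIntegral.integral_of_le hab, integral_Ioc_eq_integral_Ioo]
  ring

/-- A test function with integral zero is the derivative of a test function. -/
lemma exists_primitive_test {a b : ℝ} (θ : ℝ → ℝ) (hθ : ContDiff ℝ ∞ θ) (hc : HasCompactSupport θ)
    (hs : tsupport θ ⊆ Ioo a b) (h0 : ∫ t, θ t = 0) :
    ∃ φ : ℝ → ℝ, ContDiff ℝ ∞ φ ∧ HasCompactSupport φ ∧ tsupport φ ⊆ Ioo a b ∧ deriv φ = θ := by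
  have hderiv : ∀ t, HasDerivAt (fun t => ∫ s in a..t, θ s) (θ t) t := fun t =>
    intervalIntegral.integral_hasDerivAt_right (hθ.continuous.intervalIntegrable _ _)
      hθ.continuous.stronglyMeasurable.stronglyMeasurableAtFilter hθ.continuous.continuousAt
  obtain ⟨α, β, hα, hβ, hαβ⟩ : ∃ α β, a < α ∧ β < b ∧ tsupport θ ⊆ Icc α β := by
    rcases (tsupport θ).eq_empty_or_nonempty with he | hne
    · exact ⟨a + 1, b - 1, by linarith, by linarith, by simp [he]⟩
    · obtain ⟨α, hα, hα'⟩ := hc.isCompact.exists_isLeast hne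
      obtain ⟨β, hβ, hβ'⟩ := hc.isCompact.exists_isGreatest hne
      exact ⟨α, β, (hs hα).1, (hs hβ).2, fun t ht => ⟨hα' ht, hβ' ht⟩⟩
  have hz : ∀ t, t ∉ Icc α β → θ t = 0 := fun t ht =>
    image_eq_zero_of_notMem_tsupport fun h => ht (hαβ h)
  have hsub : Function.support (fun t => ∫ s in a..t, θ s) ⊆ Icc α β := by
    intro t ht
    by_contra hn
    apply ht
    rw [mem_Icc, not_and_or, not_le, not_le] at hn
    rcases hn with hn | hn
    · refine (intervalIntegral.integral_congr (g := fun _ => (0 : ℝ))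
        fun s hs => hz s fun h => ?_).trans (by simp)
      have h2 := max_lt hα hn
      exact absurd (h.1.trans hs.2) (not_le.mpr h2)
    · have h1 : ∫ s in a..t, θ s = ∫ s, θ s := by
        refine intervalIntegral.integral_eq_integral_of_support_subset fun s hs => ?_
        have h3 : s ∈ Icc α β := by
          by_contra h
          exact hs (hz s h)
        exact ⟨hα.trans_le h3.1, h3.2.trans hn.le⟩
      exact h1.trans h0
  have hts : tsupport (fun t => ∫ s in a..t, θ s) ⊆ Icc α β := closure_minimal hsub isClosed_Icc
  have hd : deriv (fun t => ∫ s in a..t, θ s) = θ := funext fun t => (hderiv t).deriv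
  refine ⟨fun t => ∫ s in a..t, θ s, ?_, isCompact_Icc.of_isClosed_subset isClosed_closure hts,
    hts.trans fun t ht => ⟨hα.trans_le ht.1, ht.2.trans_lt hβ⟩, hd⟩
  exact contDiff_infty_iff_deriv.mpr ⟨fun t => (hderiv t).differentiableAt, by rwa [hd]⟩

/-- The lemma of du Bois-Reymond: a function whose weak derivative vanishes is constant. -/
lemma ae_eq_const_of_integral_mul_deriv_eq_zero {a b : ℝ} (hab : a < b) {h : ℝ → ℂ}
    (hh : Integrable h (intervalMeasure a b))
    (h0 : ∀ φ : ℝ → ℂ, ContDiff ℝ ∞ φ → HasCompactSupport φ → tsupport φ ⊆ Ioo a b →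
      ∫ t in Ioo a b, h t * deriv φ t = 0) :
    ∃ c : ℂ, h =ᵐ[intervalMeasure a b] fun _ => c := by
  -- A test function `ψ` with integral `1`; each test function `η` differs from a multiple of `ψ` by
  -- the derivative of a test function.
  obtain ⟨ψ, hψ, hψc, hψs, hψ1⟩ : ∃ ψ : ℝ → ℝ, ContDiff ℝ ∞ ψ ∧ HasCompactSupport ψ ∧
      tsupport ψ ⊆ Ioo a b ∧ ∫ t, ψ t = 1 := by
    let f : ContDiffBump ((a + b) / 2) := ⟨(b - a) / 8, (b - a) / 4, by linarith, by linarith⟩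
    refine ⟨f.normed volume, f.contDiff_normed, f.hasCompactSupport_normed, ?_, f.integral_normed⟩
    rw [f.tsupport_normed_eq, Real.closedBall_eq_Icc]
    intro t ht
    have h1 : f.rOut = (b - a) / 4 := rfl
    rw [h1] at ht
    exact ⟨by linarith [ht.1], by linarith [ht.2]⟩
  refine ⟨∫ t in Ioo a b, ψ t • h t, ?_⟩
  set c := ∫ t in Ioo a b, ψ t • h t with hc
  have hsmul : ∀ η : ℝ → ℝ, Continuous η →
      Integrable (fun t => η t • h t) (intervalMeasure a b) := by
    intro η hη
    obtain ⟨C, hC⟩ := (isCompact_Icc (a := a) (b := b)).exists_bound_of_continuousOn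
      hη.continuousOn
    refine hh.bdd_smul C hη.aestronglyMeasurable ?_
    filter_upwards [ae_restrict_mem (measurableSet_Ioo (a := a) (b := b))] with t ht
    exact hC t (Ioo_subset_Icc_self ht)
  have key := isOpen_Ioo.ae_eq_zero_of_integral_contDiff_smul_eq_zero (U := Ioo a b)
    (μ := volume) (f := fun t => h t - c)
    (IntegrableOn.locallyIntegrableOn (hh.sub (integrable_const c)))
  rw [Filter.EventuallyEq, ae_restrict_iff' measurableSet_Ioo]
  refine (key fun η hη hηc hηs => ?_).mono fun t ht hm => sub_eq_zero.mp (ht hm)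
  have hηi : Integrable η := hη.continuous.integrable_of_hasCompactSupport hηc
  have hψi : Integrable ψ := hψ.continuous.integrable_of_hasCompactSupport hψc
  set m := ∫ t, η t with hm
  obtain ⟨φ, hφ, hφc, hφs, hφd⟩ := exists_primitive_test (a := a) (b := b)
    (fun t => η t - m * ψ t) (hη.sub (contDiff_const.mul hψ))
    (hηc.sub (hψc.mul_left (f := fun _ => m)))
    ((tsupport_sub _ _).trans (union_subset hηs ((tsupport_mul_subset_right).trans hψs))) (by
      rw [integral_sub hηi (hψi.const_mul m), integral_const_mul, hψ1, ← hm]; ring)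
  have hφ0 := h0 (fun t => (φ t : ℂ)) (Complex.ofRealCLM.contDiff.comp hφ)
    (hφc.comp_left Complex.ofReal_zero)
    ((tsupport_comp_subset Complex.ofReal_zero φ).trans hφs)
  have hdφ : ∀ t, deriv (fun t => (φ t : ℂ)) t = ((η t - m * ψ t : ℝ) : ℂ) := by
    intro t
    have := ((hφ.differentiable (by simp)).differentiableAt (x := t)).hasDerivAt.ofReal_comp.deriv
    rw [this, hφd]
  have e1 : ∫ t, η t • (h t - c) = ∫ t in Ioo a b, η t • (h t - c) := by
    refine (setIntegral_eq_integral_of_forall_compl_eq_zero fun t ht => ?_).symm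
    rw [image_eq_zero_of_notMem_tsupport fun h => ht (hηs h), zero_smul]
  have e2 : ∫ t in Ioo a b, η t = m := setIntegral_eq_integral_of_forall_compl_eq_zero fun t ht =>
    image_eq_zero_of_notMem_tsupport fun h => ht (hηs h)
  have e3 : ∫ t in Ioo a b, (η t - m * ψ t) • h t = 0 := by
    rw [← hφ0]
    refine setIntegral_congr_fun measurableSet_Ioo fun t _ => ?_
    simp only [hdφ t, Complex.real_smul, mul_comm]
  simp_rw [sub_smul, mul_smul] at e3
  rw [integral_sub (hsmul _ hη.continuous) ((hsmul _ hψ.continuous).fun_smul m), integral_smul,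
    ← hc, sub_eq_zero] at e3
  rw [e1]
  simp_rw [smul_sub]
  rw [integral_sub (hsmul _ hη.continuous) (hηi.integrableOn.smul_const c), e3,
    integral_smul_const, e2, sub_self]

/-! ### Traces and equations of first order -/

section Traces

variable {a b : ℝ}

lemma continuous_ofReal_sub (c : ℝ) : Continuous fun t : ℝ => (t : ℂ) - c := by fun_prop

/-- The trace `u(a)` of `u ∈ H¹(a, b)` with weak derivative `v`, as the bounded functional
`(b - a)⁻¹ ∫ (u + (t - b) v)`. -/
def traceLeft (u v : L2 a b) : ℂ :=
  ((b : ℂ) - a)⁻¹ * (pairing (fun _ => 1) continuous_const u +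
    pairing (fun t => (t : ℂ) - b) (continuous_ofReal_sub b) v)

/-- The trace `u(b)` of `u ∈ H¹(a, b)` with weak derivative `v`, as the bounded functional
`(b - a)⁻¹ ∫ (u + (t - a) v)`. -/
def traceRight (u v : L2 a b) : ℂ :=
  ((b : ℂ) - a)⁻¹ * (pairing (fun _ => 1) continuous_const u +
    pairing (fun t => (t : ℂ) - a) (continuous_ofReal_sub a) v)

/-- An element of `H¹(a, b)` is, up to a constant, the primitive of its weak derivative. -/
lemma IsWeakDeriv.exists_primitive (hab : a < b) {u v : L2 a b} (h : IsWeakDeriv u v) :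
    ∃ c : ℂ, IsContRep u (primitive a c v) := by
  have hv := integrable_coeFn v
  have hp : Integrable (primitive a 0 v) (intervalMeasure a b) :=
    (memLp_of_continuousOn_Icc (continuousOn_primitive 0 hv)).integrable (by norm_num)
  obtain ⟨c, hc⟩ := ae_eq_const_of_integral_mul_deriv_eq_zero hab
    ((integrable_coeFn u).sub hp) fun φ h1 h2 h3 => by
      have hd := h1.continuous_deriv (by simp)
      have hpd : Integrable (fun t => primitive a 0 v t * deriv φ t) (intervalMeasure a b) :=
        (memLp_of_continuousOn_Icc ((continuousOn_primitive 0 hv).mul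
          hd.continuousOn)).integrable (by norm_num)
      simp only [Pi.sub_apply, sub_mul]
      rw [integral_sub (integrable_mul_continuous u hd) hpd, h φ h1 h2 h3,
        integral_primitive_mul_deriv hab.le 0 hv (h1.of_le (by simp)),
        (apply_eq_zero_of_tsupport_subset_Ioo h3).1, (apply_eq_zero_of_tsupport_subset_Ioo h3).2]
      ring
  refine ⟨c, continuousOn_primitive c hv, hc.mono fun t ht => ?_⟩
  simp only [Pi.sub_apply, primitive, zero_add] at ht ⊢
  rw [← ht]
  ring

lemma IsContRep.eqOn (hab : a < b) {u : L2 a b} {f g : ℝ → ℂ} (hf : IsContRep u f)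
    (hg : IsContRep u g) : EqOn f g (Icc a b) := by
  refine Measure.eqOn_Icc_of_ae_eq (μ := volume) hab.ne ?_ hf.1 hg.1
  rw [← Measure.restrict_congr_set (Ioo_ae_eq_Icc (μ := volume) (a := a) (b := b))]
  exact hf.2.symm.trans hg.2

lemma hasDerivAt_ofReal_sub (c : ℂ) (t : ℝ) : HasDerivAt (fun t : ℝ => (t : ℂ) - c) 1 t := by
  simpa using ((hasDerivAt_id t).ofReal_comp).sub_const c

lemma contDiff_ofReal_sub (c : ℂ) : ContDiff ℝ 1 fun t : ℝ => (t : ℂ) - c :=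
  (Complex.ofRealCLM.contDiff).sub contDiff_const

lemma ofReal_sub_ne_zero (hab : a < b) : (b : ℂ) - a ≠ 0 := by
  rw [sub_ne_zero]
  exact_mod_cast hab.ne'

lemma IsContRep.traceLeft_eq_and_traceRight_eq (hab : a < b) {u v : L2 a b} (h : IsWeakDeriv u v)
    {f : ℝ → ℂ} (hf : IsContRep u f) : traceLeft u v = f a ∧ traceRight u v = f b := by
  obtain ⟨c, hc⟩ := h.exists_primitive hab
  have hv := integrable_coeFn v
  rw [hf.eqOn hab hc (left_mem_Icc.mpr hab.le), hf.eqOn hab hc (right_mem_Icc.mpr hab.le)]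
  -- Integration by parts against `t - d`; the choice `d = b` or `d = a` removes one boundary term.
  have key : ∀ d : ℝ, (∫ t in Ioo a b, u t * 1) =
      primitive a c v b * (b - d) - primitive a c v a * (a - d) -
        ∫ t in Ioo a b, v t * ((t : ℂ) - d) := by
    intro d
    rw [← integral_primitive_mul_deriv hab.le c hv (contDiff_ofReal_sub d)]
    refine integral_congr_ae ?_
    filter_upwards [hc.2] with t ht
    rw [ht, (hasDerivAt_ofReal_sub d t).deriv]
  have h0 := ofReal_sub_ne_zero hab
  constructor
  · rw [traceLeft, pairing_apply, pairing_apply, inv_mul_eq_iff_eq_mul₀ h0, key b]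
    ring
  · rw [traceRight, pairing_apply, pairing_apply, inv_mul_eq_iff_eq_mul₀ h0, key a]
    ring

lemma IsWeakDeriv.exists_isContRep (hab : a < b) {u v : L2 a b} (h : IsWeakDeriv u v) :
    ∃ f, IsContRep u f ∧ f a = traceLeft u v ∧ f b = traceRight u v := by
  obtain ⟨c, hc⟩ := h.exists_primitive hab
  have := hc.traceLeft_eq_and_traceRight_eq hab h
  exact ⟨_, hc, this.1.symm, this.2.symm⟩

/-- Integration by parts in `H¹(a, b)` against functions that need not vanish at the end points. -/
lemma IsWeakDeriv.integral_mul_deriv (hab : a < b) {u v : L2 a b} (h : IsWeakDeriv u v)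
    {φ : ℝ → ℂ} (hφ : ContDiff ℝ 1 φ) :
    ∫ t in Ioo a b, u t * deriv φ t =
      traceRight u v * φ b - traceLeft u v * φ a - ∫ t in Ioo a b, v t * φ t := by
  obtain ⟨c, hc⟩ := h.exists_primitive hab
  have := hc.traceLeft_eq_and_traceRight_eq hab h
  rw [this.1, this.2, ← integral_primitive_mul_deriv hab.le c (integrable_coeFn v) hφ]
  refine integral_congr_ae ?_
  filter_upwards [hc.2] with t ht
  rw [ht]

lemma contDiff_cexp_mul (c : ℂ) : ContDiff ℝ ∞ fun t : ℝ => Complex.exp (c * t) :=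
  (contDiff_const.mul Complex.ofRealCLM.contDiff).cexp

lemma hasDerivAt_cexp_mul (c : ℂ) (t : ℝ) :
    HasDerivAt (fun t : ℝ => Complex.exp (c * t)) (c * Complex.exp (c * t)) t := by
  have := (((hasDerivAt_id t).ofReal_comp).const_mul c).cexp
  simpa [mul_comm] using this

lemma deriv_cexp_mul_mul (c : ℂ) {φ : ℝ → ℂ} (hφ : ContDiff ℝ ∞ φ) (t : ℝ) :
    deriv (fun t : ℝ => Complex.exp (c * t) * φ t) t =
      Complex.exp (c * t) * deriv φ t + c * (Complex.exp (c * t) * φ t) := by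
  have h := (hasDerivAt_cexp_mul c t).mul
    ((hφ.differentiable (by simp)).differentiableAt (x := t)).hasDerivAt
  refine h.deriv.trans ?_
  ring

/-- The first order equation `u' = c u + f` with initial value `u(a) = u₀` has a solution, by the
variation of constants formula. -/
lemma exists_isWeakDeriv_smul_add (hab : a < b) (c : ℂ) (f : L2 a b) (u₀ : ℂ) :
    ∃ u : L2 a b, IsWeakDeriv u (c • u + f) ∧ traceLeft u (c • u + f) = u₀ := by
  let g : ℝ → ℂ := fun s => f s * Complex.exp (-c * s)
  have hg : Integrable g (intervalMeasure a b) :=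
    integrable_mul_continuous f (contDiff_cexp_mul (-c)).continuous
  let G := primitive a (u₀ * Complex.exp (-c * a)) g
  have hG : ContinuousOn G (Icc a b) := continuousOn_primitive _ hg
  have hU : ContinuousOn (fun t : ℝ => G t * Complex.exp (c * t)) (Icc a b) :=
    hG.mul (contDiff_cexp_mul c).continuous.continuousOn
  let u : L2 a b := (memLp_of_continuousOn_Icc hU).toLp
  have hu : IsContRep u fun t : ℝ => G t * Complex.exp (c * t) :=
    ⟨hU, (memLp_of_continuousOn_Icc hU).coeFn_toLp⟩
  have hw : IsWeakDeriv u (c • u + f) := by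
    intro φ h1 h2 h3
    have hψ : ContDiff ℝ ∞ fun t : ℝ => Complex.exp (c * t) * φ t := (contDiff_cexp_mul c).mul h1
    have h4 := integral_primitive_mul_deriv hab.le (u₀ * Complex.exp (-c * a)) hg
      (hψ.of_le (by simp))
    have h5 : ∫ t in Ioo a b, g t * (Complex.exp (c * t) * φ t) = ∫ t in Ioo a b, f t * φ t := by
      refine setIntegral_congr_fun measurableSet_Ioo fun t _ => ?_
      have : Complex.exp (-c * t) * Complex.exp (c * t) = 1 := by
        rw [← Complex.exp_add]
        simp
      linear_combination f t * φ t * this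
    have h6 : ∫ t in Ioo a b, G t * deriv (fun t : ℝ => Complex.exp (c * t) * φ t) t =
        (∫ t in Ioo a b, u t * deriv φ t) + c * ∫ t in Ioo a b, u t * φ t := by
      rw [← integral_const_mul, ← integral_add (integrable_mul_continuous u
        (h1.continuous_deriv (by simp))) ((integrable_mul_continuous u h1.continuous).const_mul c)]
      refine integral_congr_ae ?_
      filter_upwards [hu.2] with t ht
      rw [deriv_cexp_mul_mul c h1, ht]
      ring
    rw [h5, (apply_eq_zero_of_tsupport_subset_Ioo h3).1,
      (apply_eq_zero_of_tsupport_subset_Ioo h3).2, h6] at h4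
    rw [integral_add_mul _ _ h1.continuous, integral_smul_mul]
    linear_combination h4
  refine ⟨u, hw, ?_⟩
  rw [(hu.traceLeft_eq_and_traceRight_eq hab hw).1]
  have : Complex.exp (-c * a) * Complex.exp (c * a) = 1 := by
    rw [← Complex.exp_add]
    simp
  simp only [G, primitive_left]
  linear_combination u₀ * this

/-- Solutions of `u' = c u` are multiples of `exp(c t)`, as the weak derivative of `exp(-c t) u`
vanishes. -/
lemma IsWeakDeriv.exists_eq_exp (hab : a < b) {c : ℂ} {u : L2 a b} (h : IsWeakDeriv u (c • u)) :
    ∃ k : ℂ, IsContRep u fun t => k * Complex.exp (c * t) := by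
  obtain ⟨k, hk⟩ := ae_eq_const_of_integral_mul_deriv_eq_zero hab
    (integrable_mul_continuous u (contDiff_cexp_mul (-c)).continuous) fun φ h1 h2 h3 => by
      have hψ : ContDiff ℝ ∞ fun t : ℝ => Complex.exp (-c * t) * φ t :=
        (contDiff_cexp_mul (-c)).mul h1
      have h4 := h _ hψ h2.mul_left (tsupport_mul_subset_right.trans h3)
      rw [integral_smul_mul] at h4
      have h6 : ∫ t in Ioo a b, u t * deriv (fun t : ℝ => Complex.exp (-c * t) * φ t) t =
          (∫ t in Ioo a b, u t * Complex.exp (-c * t) * deriv φ t) +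
            -c * ∫ t in Ioo a b, u t * (Complex.exp (-c * t) * φ t) := by
        have h7 := integrable_mul_continuous u ((contDiff_cexp_mul (-c)).continuous.mul
          (h1.continuous_deriv (by simp)))
        rw [← integral_const_mul, ← integral_add (by simpa only [Pi.mul_apply, mul_assoc] using h7)
          ((integrable_mul_continuous u hψ.continuous).const_mul _)]
        refine setIntegral_congr_fun measurableSet_Ioo fun t _ => ?_
        simp only [deriv_cexp_mul_mul (-c) h1]
        ring
      rw [h6] at h4
      linear_combination h4
  refine ⟨k, (continuous_const.mul (contDiff_cexp_mul c).continuous).continuousOn,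
    hk.mono fun t ht => ?_⟩
  have : Complex.exp (-c * t) * Complex.exp (c * t) = 1 := by
    rw [← Complex.exp_add]
    simp
  simp only at ht
  linear_combination Complex.exp (c * t) * ht - u t * this

lemma IsWeakDeriv.eq_zero_of_traceLeft (hab : a < b) {c : ℂ} {u : L2 a b}
    (h : IsWeakDeriv u (c • u)) (h0 : traceLeft u (c • u) = 0) : u = 0 := by
  obtain ⟨k, hk⟩ := h.exists_eq_exp hab
  rw [(hk.traceLeft_eq_and_traceRight_eq hab h).1, mul_eq_zero,
    or_iff_left (Complex.exp_ne_zero _)] at h0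
  rw [Lp.eq_zero_iff_ae_eq_zero]
  filter_upwards [hk.2] with t ht
  rw [ht, h0, zero_mul, Pi.zero_apply]

lemma IsWeakDeriv.traceRight_eq_exp_mul (hab : a < b) {c : ℂ} {u : L2 a b}
    (h : IsWeakDeriv u (c • u)) :
    traceRight u (c • u) = Complex.exp (c * (b - a)) * traceLeft u (c • u) := by
  obtain ⟨k, hk⟩ := h.exists_eq_exp hab
  rw [(hk.traceLeft_eq_and_traceRight_eq hab h).1, (hk.traceLeft_eq_and_traceRight_eq hab h).2,
    mul_left_comm, ← Complex.exp_add]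
  congr 3
  ring

end Traces

/-! ### The Cauchy problem in `H²(a, b)` -/

section Interval

variable {a b : ℝ}

lemma isClosed_setOf_isWeakDeriv {X : Type*} [TopologicalSpace X] {u v : X → L2 a b}
    (hu : Continuous u) (hv : Continuous v) : IsClosed {x | IsWeakDeriv (u x) (v x)} := by
  simp only [IsWeakDeriv, Set.ofPred_forall]
  refine isClosed_iInter fun φ => isClosed_iInter fun h1 => isClosed_iInter fun _ =>
    isClosed_iInter fun _ => ?_
  have hd := h1.continuous_deriv (by simp)
  simp_rw [← pairing_apply hd, ← pairing_apply h1.continuous]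
  exact isClosed_eq ((pairing _ hd).continuous.comp hu)
    (((pairing _ h1.continuous).continuous.comp hv).neg)

instance : CompleteSpace (SobolevH2 a b) := by
  have hp : ∀ k : Fin 3, Continuous fun u : PiLp 2 (fun _ : Fin 3 => L2 a b) => u k := fun k =>
    (PiLp.proj 2 (fun _ : Fin 3 => L2 a b) k : _ →L[ℂ] L2 a b).continuous
  exact (show IsClosed (SobolevH2 a b : Set (PiLp 2 (fun _ : Fin 3 => L2 a b))) from
    (isClosed_setOf_isWeakDeriv (hp 0) (hp 1)).inter
      (isClosed_setOf_isWeakDeriv (hp 1) (hp 2))).completeSpace_coe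

lemma isWeakDeriv_derivL (u : SobolevH2 a b) :
    IsWeakDeriv (derivL a b 0 u) (derivL a b 1 u) ∧ IsWeakDeriv (derivL a b 1 u) (derivL a b 2 u) :=
  u.2

lemma traceLeft_add (u v u' v' : L2 a b) :
    traceLeft (u + u') (v + v') = traceLeft u v + traceLeft u' v' := by
  simp only [traceLeft, map_add]
  ring

lemma traceLeft_smul (c : ℂ) (u v : L2 a b) : traceLeft (c • u) (c • v) = c * traceLeft u v := by
  simp only [traceLeft, map_smul, smul_eq_mul]
  ring

lemma traceRight_add (u v u' v' : L2 a b) :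
    traceRight (u + u') (v + v') = traceRight u v + traceRight u' v' := by
  simp only [traceRight, map_add]
  ring

lemma traceRight_smul (c : ℂ) (u v : L2 a b) :
    traceRight (c • u) (c • v) = c * traceRight u v := by
  simp only [traceRight, map_smul, smul_eq_mul]
  ring

/-- The trace at `a` of the derivative of order `i`, as a bounded functional on `H²(a, b)`. The
index `j` is that of the next derivative: only `j = i + 1` is meaningful. -/
def traceLeftL (a b : ℝ) (i j : Fin 3) : SobolevH2 a b →L[ℂ] ℂ :=
  ((b : ℂ) - a)⁻¹ • ((pairing (fun _ => 1) continuous_const).comp (derivL a b i) +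
    (pairing (fun t => (t : ℂ) - b) (continuous_ofReal_sub b)).comp (derivL a b j))

/-- The trace at `b` of the derivative of order `i`, as a bounded functional on `H²(a, b)`. The
index `j` is that of the next derivative: only `j = i + 1` is meaningful. -/
def traceRightL (a b : ℝ) (i j : Fin 3) : SobolevH2 a b →L[ℂ] ℂ :=
  ((b : ℂ) - a)⁻¹ • ((pairing (fun _ => 1) continuous_const).comp (derivL a b i) +
    (pairing (fun t => (t : ℂ) - a) (continuous_ofReal_sub a)).comp (derivL a b j))

lemma traceLeftL_apply (i j : Fin 3) (u : SobolevH2 a b) :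
    traceLeftL a b i j u = traceLeft (derivL a b i u) (derivL a b j u) := rfl

lemma traceRightL_apply (i j : Fin 3) (u : SobolevH2 a b) :
    traceRightL a b i j u = traceRight (derivL a b i u) (derivL a b j u) := rfl

lemma I_mul_sq (z : ℂ) : (Complex.I * z) * (Complex.I * z) = -z ^ 2 := by
  linear_combination z ^ 2 * Complex.I_mul_I

/-- Existence for the Cauchy problem `z² u + u'' = f`, `u(a) = u₀`, `u'(a) = u₁`. The equation
factors as `(∂ + iz)(∂ - iz) u = f`. -/
lemma exists_cauchy (hab : a < b) (z : ℂ) (f : L2 a b) (u₀ u₁ : ℂ) :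
    ∃ u : SobolevH2 a b, z ^ 2 • derivL a b 0 u + derivL a b 2 u = f ∧
      traceLeftL a b 0 1 u = u₀ ∧ traceLeftL a b 1 2 u = u₁ := by
  set c := Complex.I * z with hc
  obtain ⟨w, hw, hw0⟩ := exists_isWeakDeriv_smul_add hab (-c) f (u₁ - c * u₀)
  obtain ⟨u, hu, hu0⟩ := exists_isWeakDeriv_smul_add hab c w u₀
  have hu2 : IsWeakDeriv (c • u + w) (c • (c • u + w) + (-c • w + f)) := (hu.smul c).add hw
  refine ⟨⟨WithLp.toLp 2 ![u, c • u + w, c • (c • u + w) + (-c • w + f)], hu, hu2⟩, ?_, hu0, ?_⟩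
  · change z ^ 2 • u + (c • (c • u + w) + (-c • w + f)) = f
    rw [smul_add, smul_smul, I_mul_sq, neg_smul, neg_smul]
    abel
  · change traceLeft (c • u + w) (c • (c • u + w) + (-c • w + f)) = u₁
    rw [traceLeft_add, traceLeft_smul, hu0, hw0]
    ring

/-- If `z² u + u'' = 0`, then `w = u' - c u` with `c = ± iz` satisfies `w' = -c w`. -/
lemma factor_isWeakDeriv {z c : ℂ} (hc : c * c = -z ^ 2) {u : SobolevH2 a b}
    (h : z ^ 2 • derivL a b 0 u + derivL a b 2 u = 0) :
    IsWeakDeriv (derivL a b 1 u + -c • derivL a b 0 u)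
      (-c • (derivL a b 1 u + -c • derivL a b 0 u)) ∧
    derivL a b 2 u + -c • derivL a b 1 u = -c • (derivL a b 1 u + -c • derivL a b 0 u) := by
  have e : derivL a b 2 u + -c • derivL a b 1 u =
      -c • (derivL a b 1 u + -c • derivL a b 0 u) := by
    rw [smul_add, smul_smul, neg_mul_neg, hc, eq_neg_of_add_eq_zero_right h,
      neg_smul (z ^ 2), add_comm]
  refine ⟨?_, e⟩
  rw [← e]
  exact (isWeakDeriv_derivL u).2.add ((isWeakDeriv_derivL u).1.smul (-c))

/-- Uniqueness for the Cauchy problem. -/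
lemma eq_zero_of_cauchy (hab : a < b) {z : ℂ} {u : SobolevH2 a b}
    (h : z ^ 2 • derivL a b 0 u + derivL a b 2 u = 0) (h0 : traceLeftL a b 0 1 u = 0)
    (h1 : traceLeftL a b 1 2 u = 0) : u = 0 := by
  rw [traceLeftL_apply] at h0 h1
  set c := Complex.I * z with hc
  obtain ⟨hw, e⟩ := factor_isWeakDeriv (I_mul_sq z) h
  have hw0 := hw.eq_zero_of_traceLeft hab (by
    rw [← e, traceLeft_add, traceLeft_smul, h0, h1, mul_zero, add_zero])
  have e1 : derivL a b 1 u = c • derivL a b 0 u := by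
    rw [neg_smul, add_neg_eq_zero] at hw0
    exact hw0
  have h01 := (isWeakDeriv_derivL u).1
  rw [e1] at h01 h0
  have e0 := h01.eq_zero_of_traceLeft hab h0
  rw [e0, smul_zero] at e1
  rw [e0, smul_zero, zero_add] at h
  refine Subtype.ext (PiLp.ext fun k => ?_)
  fin_cases k
  · exact e0
  · exact e1
  · exact h

/-- The characteristic combinations `u' - c u`, `c = ± iz`, of a solution of `z² u + u'' = 0` are
multiplied by `exp(-c (b - a))` from `a` to `b`. -/
lemma traceRightL_sub_eq (hab : a < b) {z c : ℂ} (hc : c * c = -z ^ 2) {u : SobolevH2 a b}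
    (h : z ^ 2 • derivL a b 0 u + derivL a b 2 u = 0) :
    traceRightL a b 1 2 u - c * traceRightL a b 0 1 u =
      Complex.exp (-c * (b - a)) * (traceLeftL a b 1 2 u - c * traceLeftL a b 0 1 u) := by
  obtain ⟨hw, e⟩ := factor_isWeakDeriv hc h
  have := hw.traceRight_eq_exp_mul hab
  rw [← e, traceRight_add, traceRight_smul, traceLeft_add, traceLeft_smul] at this
  simp only [traceRightL_apply, traceLeftL_apply]
  linear_combination this

end Interval

/-! ### Matching conditions on the circle -/

lemma tendsto_integral_mul_cos_pow {a b t₀ : ℝ} (D : L2 a b)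
    (h : ∀ t ∈ Ioo a b, Real.cos (t - t₀) ≠ 1) :
    Tendsto (fun n : ℕ => ∫ t in Ioo a b, D t * ((((1 + Real.cos (t - t₀)) / 2) ^ n : ℝ) : ℂ)) atTop
      (𝓝 0) := by
  have hb : ∀ t, 0 ≤ (1 + Real.cos (t - t₀)) / 2 ∧ (1 + Real.cos (t - t₀)) / 2 ≤ 1 := fun t =>
    ⟨by linarith [Real.neg_one_le_cos (t - t₀)], by linarith [Real.cos_le_one (t - t₀)]⟩
  have := tendsto_integral_of_dominated_convergence (μ := intervalMeasure a b)
    (F := fun (n : ℕ) t => D t * ((((1 + Real.cos (t - t₀)) / 2) ^ n : ℝ) : ℂ)) (f := fun _ => 0)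
    (fun t => ‖D t‖) (fun n => ?_) (integrable_coeFn D).norm (fun n => ?_) ?_
  · simpa using this
  · exact (integrable_mul_continuous D (by fun_prop)).aestronglyMeasurable
  · refine Eventually.of_forall fun t => ?_
    rw [norm_mul, Complex.norm_real, Real.norm_of_nonneg (pow_nonneg (hb t).1 n)]
    exact mul_le_of_le_one_right (norm_nonneg _) (pow_le_one₀ (hb t).1 (hb t).2)
  · filter_upwards [ae_restrict_mem (measurableSet_Ioo (a := a) (b := b))] with t ht
    have h1 : (1 + Real.cos (t - t₀)) / 2 < 1 := by
      have := lt_of_le_of_ne (Real.cos_le_one (t - t₀)) (h t ht)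
      linarith
    have h2 := (tendsto_pow_atTop_nhds_zero_of_lt_one (hb t).1 h1).ofReal
    simpa using h2.const_mul (D t)

lemma cos_sub_ne_one {t t₀ : ℝ} (h1 : t₀ - 2 * Real.pi < t) (h2 : t < t₀ + 2 * Real.pi)
    (h : t ≠ t₀) : Real.cos (t - t₀) ≠ 1 := by
  rw [Ne, Real.cos_eq_one_iff_of_lt_of_lt (by linarith) (by linarith), sub_eq_zero]
  exact h

/-- Two point masses on the circle are not represented by a square integrable function: the smooth
functions `((1 + cos (t - t₀)) / 2) ^ n` are `1` at `t₀` and tend to `0` elsewhere. -/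
lemma eq_zero_of_forall_periodic {α β : ℂ} {D : L2 0 (Real.pi / 2)}
    {D' : L2 (Real.pi / 2) (2 * Real.pi)}
    (h : ∀ φ : ℝ → ℂ, ContDiff ℝ ∞ φ → Function.Periodic φ (2 * Real.pi) →
      α * φ (Real.pi / 2) + β * φ 0 =
        (∫ t in Ioo 0 (Real.pi / 2), D t * φ t) +
          ∫ t in Ioo (Real.pi / 2) (2 * Real.pi), D' t * φ t) : α = 0 ∧ β = 0 := by
  have hpi := Real.pi_pos
  have key : ∀ t₀ : ℝ, (∀ t ∈ Ioo 0 (Real.pi / 2), Real.cos (t - t₀) ≠ 1) →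
      (∀ t ∈ Ioo (Real.pi / 2) (2 * Real.pi), Real.cos (t - t₀) ≠ 1) →
      Tendsto (fun n : ℕ => α * ((((1 + Real.cos (Real.pi / 2 - t₀)) / 2) ^ n : ℝ) : ℂ) +
        β * ((((1 + Real.cos (0 - t₀)) / 2) ^ n : ℝ) : ℂ)) atTop (𝓝 0) := by
    intro t₀ h1 h2
    have := (tendsto_integral_mul_cos_pow D h1).add (tendsto_integral_mul_cos_pow D' h2)
    rw [add_zero] at this
    refine this.congr fun n => (h _ ?_ fun t => ?_).symm
    · exact Complex.ofRealCLM.contDiff.comp (ContDiff.pow (ContDiff.div_const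
        (contDiff_const.add (Real.contDiff_cos.comp (contDiff_id.sub contDiff_const))) 2) n)
    · simp only [add_sub_right_comm, Real.cos_add_two_pi]
  have h2 : Tendsto (fun n : ℕ => (((1 / 2 : ℝ) ^ n : ℝ) : ℂ)) atTop (𝓝 0) := by
    simpa using (tendsto_pow_atTop_nhds_zero_of_lt_one (r := (1 / 2 : ℝ)) (by norm_num)
      (by norm_num)).ofReal
  constructor
  · have h1 := key (Real.pi / 2)
      (fun t ht => cos_sub_ne_one (by linarith [ht.1]) (by linarith [ht.2]) ht.2.ne)
      (fun t ht => cos_sub_ne_one (by linarith [ht.1]) (by linarith [ht.2]) ht.1.ne')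
    have h3 : Tendsto (fun n : ℕ => α * 1 + β * (((1 / 2 : ℝ) ^ n : ℝ) : ℂ)) atTop
        (𝓝 (α * 1 + β * 0)) := tendsto_const_nhds.add (h2.const_mul β)
    simp only [sub_self, Real.cos_zero, zero_sub, Real.cos_neg, Real.cos_pi_div_two] at h1
    norm_num at h1 h3
    exact tendsto_nhds_unique h3 h1
  · have h1 := key 0
      (fun t ht => cos_sub_ne_one (by linarith [ht.1]) (by linarith [ht.2]) ht.1.ne')
      (fun t ht => cos_sub_ne_one (by linarith [ht.1]) (by linarith [ht.2])
        (show (0 : ℝ) < t by linarith [ht.1]).ne')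
    have h3 : Tendsto (fun n : ℕ => α * (((1 / 2 : ℝ) ^ n : ℝ) : ℂ) + β * 1) atTop
        (𝓝 (α * 0 + β * 1)) := (h2.const_mul α).add tendsto_const_nhds
    simp only [sub_zero, Real.cos_zero, Real.cos_pi_div_two] at h1
    norm_num at h1 h3
    exact tendsto_nhds_unique h3 h1

/-- An element of `H²(G₋) × H²(G₊)` belongs to `H¹(G)` if and only if its one-sided values agree at
the two common end points of the arcs. -/
lemma memH1Circle_iff (W : H2Pieces) :
    MemH1Circle (piecewiseDeriv 1 1 0 W) ↔
      traceRightL _ _ 0 1 W.fst = traceLeftL _ _ 0 1 W.snd ∧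
        traceRightL _ _ 0 1 W.snd = traceLeftL _ _ 0 1 W.fst := by
  have hpi := Real.pi_pos
  have h1 : (0 : ℝ) < Real.pi / 2 := by linarith
  have h2 : Real.pi / 2 < 2 * Real.pi := by linarith
  have hfst : (piecewiseDeriv 1 1 0 W).fst = derivL _ _ 0 W.fst := one_smul ℂ _
  have hsnd : (piecewiseDeriv 1 1 0 W).snd = derivL _ _ 0 W.snd := one_smul ℂ _
  have key : ∀ φ : ℝ → ℂ, ContDiff ℝ ∞ φ → Function.Periodic φ (2 * Real.pi) →
      (∫ t in Ioo 0 (Real.pi / 2), derivL _ _ 0 W.fst t * deriv φ t) +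
        (∫ t in Ioo (Real.pi / 2) (2 * Real.pi), derivL _ _ 0 W.snd t * deriv φ t) =
      (traceRightL _ _ 0 1 W.fst - traceLeftL _ _ 0 1 W.snd) * φ (Real.pi / 2) +
        (traceRightL _ _ 0 1 W.snd - traceLeftL _ _ 0 1 W.fst) * φ 0 -
        ((∫ t in Ioo 0 (Real.pi / 2), derivL _ _ 1 W.fst t * φ t) +
          ∫ t in Ioo (Real.pi / 2) (2 * Real.pi), derivL _ _ 1 W.snd t * φ t) := by
    intro φ hφ hp
    have hφ1 : ContDiff ℝ 1 φ := hφ.of_le (by simp)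
    have h3 : φ (2 * Real.pi) = φ 0 := by simpa using hp 0
    rw [(isWeakDeriv_derivL W.fst).1.integral_mul_deriv h1 hφ1,
      (isWeakDeriv_derivL W.snd).1.integral_mul_deriv h2 hφ1, h3]
    simp only [traceLeftL_apply, traceRightL_apply]
    ring
  simp only [MemH1Circle, hfst, hsnd]
  constructor
  · rintro ⟨V, hV⟩
    have := eq_zero_of_forall_periodic (α := traceRightL _ _ 0 1 W.fst - traceLeftL _ _ 0 1 W.snd)
      (β := traceRightL _ _ 0 1 W.snd - traceLeftL _ _ 0 1 W.fst)
      (D := derivL _ _ 1 W.fst + (-1 : ℂ) • V.fst) (D' := derivL _ _ 1 W.snd + (-1 : ℂ) • V.snd)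
      fun φ hφ hp => by
        rw [integral_add_mul _ _ hφ.continuous, integral_add_mul _ _ hφ.continuous,
          integral_smul_mul, integral_smul_mul]
        linear_combination hV φ hφ hp - key φ hφ hp
    exact ⟨sub_eq_zero.mp this.1, sub_eq_zero.mp this.2⟩
  · rintro ⟨e1, e2⟩
    refine ⟨WithLp.toLp 2 (derivL _ _ 1 W.fst, derivL _ _ 1 W.snd), fun φ hφ hp => ?_⟩
    rw [key φ hφ hp, e1, e2]
    simp

lemma transmission_iff (aMinus aPlus : ℂ) (W : H2Pieces) :
    Transmission aMinus aPlus W ↔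
      aPlus * traceRightL _ _ 1 2 W.snd - aMinus * traceLeftL _ _ 1 2 W.fst = 0 ∧
        aPlus * traceLeftL _ _ 1 2 W.snd - aMinus * traceRightL _ _ 1 2 W.fst = 0 := by
  have hpi := Real.pi_pos
  have h1 : (0 : ℝ) < Real.pi / 2 := by linarith
  have h2 : Real.pi / 2 < 2 * Real.pi := by linarith
  have hm := (isWeakDeriv_derivL W.fst).2
  have hp := (isWeakDeriv_derivL W.snd).2
  simp only [traceLeftL_apply, traceRightL_apply]
  constructor
  · rintro ⟨f, g, hf, hg, e1, e2⟩
    have h3 := hf.traceLeft_eq_and_traceRight_eq h1 hm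
    have h4 := hg.traceLeft_eq_and_traceRight_eq h2 hp
    rw [h3.1, h3.2, h4.1, h4.2]
    exact ⟨e1, e2⟩
  · rintro ⟨e1, e2⟩
    obtain ⟨f, hf, hfl, hfr⟩ := hm.exists_isContRep h1
    obtain ⟨g, hg, hgl, hgr⟩ := hp.exists_isContRep h2
    exact ⟨f, g, hf, hg, by rw [hfl, hgr, e1], by rw [hfr, hgl, e2]⟩

/-- The initial values of `W₋`, `W₋'` at `0` and of `W₊`, `W₊'` at `π/2`. -/
def cauchyData : H2Pieces →L[ℂ] Fin 4 → ℂ :=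
  ContinuousLinearMap.pi
    ![(traceLeftL _ _ 0 1).comp (WithLp.fstL 2 ℂ _ _),
      (traceLeftL _ _ 1 2).comp (WithLp.fstL 2 ℂ _ _),
      (traceLeftL _ _ 0 1).comp (WithLp.sndL 2 ℂ _ _),
      (traceLeftL _ _ 1 2).comp (WithLp.sndL 2 ℂ _ _)]

/-- The jumps of the values and of the weighted derivatives at the two common end points of the
arcs. -/
def jumps (aMinus aPlus : ℂ) : H2Pieces →L[ℂ] Fin 4 → ℂ :=
  ContinuousLinearMap.pi
    ![(traceRightL _ _ 0 1).comp (WithLp.fstL 2 ℂ _ _) -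
        (traceLeftL _ _ 0 1).comp (WithLp.sndL 2 ℂ _ _),
      (traceRightL _ _ 0 1).comp (WithLp.sndL 2 ℂ _ _) -
        (traceLeftL _ _ 0 1).comp (WithLp.fstL 2 ℂ _ _),
      aPlus • (traceRightL _ _ 1 2).comp (WithLp.sndL 2 ℂ _ _) -
        aMinus • (traceLeftL _ _ 1 2).comp (WithLp.fstL 2 ℂ _ _),
      aPlus • (traceLeftL _ _ 1 2).comp (WithLp.sndL 2 ℂ _ _) -
        aMinus • (traceRightL _ _ 1 2).comp (WithLp.fstL 2 ℂ _ _)]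

lemma cauchyData_eq_iff (W : H2Pieces) (c : Fin 4 → ℂ) :
    cauchyData W = c ↔ (traceLeftL _ _ 0 1 W.fst = c 0 ∧ traceLeftL _ _ 1 2 W.fst = c 1) ∧
      traceLeftL _ _ 0 1 W.snd = c 2 ∧ traceLeftL _ _ 1 2 W.snd = c 3 := by
  rw [funext_iff, Fin.forall_fin_succ, Fin.forall_fin_succ, Fin.forall_fin_two, and_assoc]
  rfl

lemma jumps_eq_zero_iff (aMinus aPlus : ℂ) (W : H2Pieces) :
    jumps aMinus aPlus W = 0 ↔
      (traceRightL _ _ 0 1 W.fst - traceLeftL _ _ 0 1 W.snd = 0 ∧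
        traceRightL _ _ 0 1 W.snd - traceLeftL _ _ 0 1 W.fst = 0) ∧
      aPlus * traceRightL _ _ 1 2 W.snd - aMinus * traceLeftL _ _ 1 2 W.fst = 0 ∧
        aPlus * traceLeftL _ _ 1 2 W.snd - aMinus * traceRightL _ _ 1 2 W.fst = 0 := by
  rw [funext_iff, Fin.forall_fin_succ, Fin.forall_fin_succ, Fin.forall_fin_two, and_assoc]
  rfl

lemma mem_EHatSubmodule_iff (aMinus aPlus : ℂ) (W : H2Pieces) :
    W ∈ EHatSubmodule aMinus aPlus ↔ jumps aMinus aPlus W = 0 := by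
  rw [jumps_eq_zero_iff, ← transmission_iff, sub_eq_zero, sub_eq_zero, ← memH1Circle_iff]
  rfl

/-! ### The symbol -/

/-- The operator `W ↦ (aMinus (z² + ∂²) W₋, aPlus (z² + ∂²) W₊)` on all of `H²(G₋) × H²(G₊)`. -/
def fullSymbol (aMinus aPlus z : ℂ) : H2Pieces →L[ℂ] L2Circle :=
  z ^ 2 • piecewiseDeriv aMinus aPlus 0 + piecewiseDeriv aMinus aPlus 2

lemma fullSymbol_eq_iff {aMinus aPlus : ℂ} (hMinus : aMinus ≠ 0) (hPlus : aPlus ≠ 0) (z : ℂ)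
    (W : H2Pieces) (f : L2Circle) :
    fullSymbol aMinus aPlus z W = f ↔
      z ^ 2 • derivL _ _ 0 W.fst + derivL _ _ 2 W.fst = aMinus⁻¹ • f.fst ∧
        z ^ 2 • derivL _ _ 0 W.snd + derivL _ _ 2 W.snd = aPlus⁻¹ • f.snd := by
  have h1 : (fullSymbol aMinus aPlus z W).fst =
      aMinus • (z ^ 2 • derivL _ _ 0 W.fst + derivL _ _ 2 W.fst) := by
    rw [smul_add, smul_comm]
    rfl
  have h2 : (fullSymbol aMinus aPlus z W).snd =
      aPlus • (z ^ 2 • derivL _ _ 0 W.snd + derivL _ _ 2 W.snd) := by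
    rw [smul_add, smul_comm]
    rfl
  rw [eq_inv_smul_iff₀ hMinus, eq_inv_smul_iff₀ hPlus, ← h1, ← h2, WithLp.ext_iff, Prod.ext_iff]
  rfl

lemma isInvertible_fullSymbol_prod_cauchyData {aMinus aPlus : ℂ} (hMinus : aMinus ≠ 0)
    (hPlus : aPlus ≠ 0) (z : ℂ) :
    ((fullSymbol aMinus aPlus z).prod cauchyData).IsInvertible := by
  have hpi := Real.pi_pos
  have h1 : (0 : ℝ) < Real.pi / 2 := by linarith
  have h2 : Real.pi / 2 < 2 * Real.pi := by linarith
  refine isInvertible_of_bijective ⟨(injective_iff_map_eq_zero _).mpr fun W hW => ?_, ?_⟩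
  · rw [ContinuousLinearMap.prod_apply, Prod.mk_eq_zero, fullSymbol_eq_iff hMinus hPlus,
      cauchyData_eq_iff] at hW
    obtain ⟨⟨e1, e2⟩, ⟨e3, e4⟩, e5, e6⟩ := hW
    rw [WithLp.zero_fst, smul_zero] at e1
    rw [WithLp.zero_snd, smul_zero] at e2
    have h3 := eq_zero_of_cauchy h1 e1 e3 e4
    have h4 := eq_zero_of_cauchy h2 e2 e5 e6
    rw [WithLp.ext_iff]
    exact Prod.ext h3 h4
  · rintro ⟨f, c⟩
    obtain ⟨u, hu, hu0, hu1⟩ := exists_cauchy h1 z (aMinus⁻¹ • f.fst) (c 0) (c 1)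
    obtain ⟨v, hv, hv0, hv1⟩ := exists_cauchy h2 z (aPlus⁻¹ • f.snd) (c 2) (c 3)
    refine ⟨WithLp.toLp 2 (u, v), Prod.ext ?_ ?_⟩
    · exact (fullSymbol_eq_iff hMinus hPlus z _ f).mpr ⟨hu, hv⟩
    · exact (cauchyData_eq_iff _ c).mpr ⟨⟨hu0, hu1⟩, hv0, hv1⟩

/-- At `z = 2/3` the symbol is injective, whatever the constants: solutions of `W'' = -z² W` change
sign across the arc of length `3π/2`, so they would change sign across the other arc, on which the
characteristic combinations are multiplied by `exp(± iπ/3) ≠ -1`. -/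
lemma eq_zero_of_fullSymbol_two_thirds {aMinus aPlus : ℂ} (hMinus : aMinus ≠ 0)
    (hPlus : aPlus ≠ 0) {W : H2Pieces} (hW : fullSymbol aMinus aPlus (2 / 3) W = 0)
    (hB : jumps aMinus aPlus W = 0) : W = 0 := by
  have hpi := Real.pi_pos
  have h1 : (0 : ℝ) < Real.pi / 2 := by linarith
  have h2 : Real.pi / 2 < 2 * Real.pi := by linarith
  have hW' := hW
  rw [fullSymbol_eq_iff hMinus hPlus, WithLp.zero_fst, WithLp.zero_snd, smul_zero, smul_zero] at hW'
  obtain ⟨e1, e2⟩ := hW'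
  obtain ⟨⟨j1, j2⟩, j3, j4⟩ := (jumps_eq_zero_iff _ _ _).mp hB
  have hI := I_mul_sq (2 / 3)
  have hI' : (-(Complex.I * (2 / 3))) * (-(Complex.I * (2 / 3))) = -(2 / 3 : ℂ) ^ 2 := by
    rw [neg_mul_neg, hI]
  have p1 := traceRightL_sub_eq h1 hI e1
  have p2 := traceRightL_sub_eq h1 hI' e1
  have q1 := traceRightL_sub_eq h2 hI e2
  have q2 := traceRightL_sub_eq h2 hI' e2
  rw [show -(Complex.I * (2 / 3)) * (((2 * Real.pi : ℝ) : ℂ) - ((Real.pi / 2 : ℝ) : ℂ)) =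
    -(Real.pi * Complex.I) by push_cast; ring, Complex.exp_neg, Complex.exp_pi_mul_I] at q1
  rw [show -(-(Complex.I * (2 / 3))) * (((2 * Real.pi : ℝ) : ℂ) - ((Real.pi / 2 : ℝ) : ℂ)) =
    Real.pi * Complex.I by push_cast; ring, Complex.exp_pi_mul_I] at q2
  have hexp : ∀ x : ℝ, Real.cos x = 1 / 2 → Complex.exp (x * Complex.I) + 1 ≠ 0 := by
    intro x hx h
    have := congrArg Complex.re h
    rw [Complex.add_re, Complex.exp_ofReal_mul_I_re, hx] at this
    norm_num at this
  rw [show -(Complex.I * (2 / 3)) * (((Real.pi / 2 : ℝ) : ℂ) - ((0 : ℝ) : ℂ)) =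
    ((-(Real.pi / 3) : ℝ) : ℂ) * Complex.I by push_cast; ring] at p1
  rw [show -(-(Complex.I * (2 / 3))) * (((Real.pi / 2 : ℝ) : ℂ) - ((0 : ℝ) : ℂ)) =
    ((Real.pi / 3 : ℝ) : ℂ) * Complex.I by push_cast; ring] at p2
  have x1 := hexp (-(Real.pi / 3)) (by rw [Real.cos_neg, Real.cos_pi_div_three])
  have x2 := hexp (Real.pi / 3) Real.cos_pi_div_three
  have hc : Complex.I * (2 / 3) ≠ 0 := mul_ne_zero Complex.I_ne_zero (by norm_num)
  generalize Complex.exp (((-(Real.pi / 3) : ℝ) : ℂ) * Complex.I) = ζ at p1 x1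
  generalize Complex.exp (((Real.pi / 3 : ℝ) : ℂ) * Complex.I) = η at p2 x2
  generalize Complex.I * (2 / 3) = c at p1 p2 q1 q2 hc
  -- The values and derivatives change sign across the arc of length `3π/2`.
  have s1 : traceRightL _ _ 1 2 W.snd = -traceLeftL _ _ 1 2 W.snd := by
    linear_combination (q1 + q2) / 2
  have s2 : traceRightL _ _ 0 1 W.snd = -traceLeftL _ _ 0 1 W.snd := by
    refine mul_left_cancel₀ hc ?_
    linear_combination (q2 - q1) / 2
  -- Hence they change sign across the other arc.
  have s3 : traceRightL _ _ 0 1 W.fst = -traceLeftL _ _ 0 1 W.fst := by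
    linear_combination j1 + s2 - j2
  have s4 : traceRightL _ _ 1 2 W.fst = -traceLeftL _ _ 1 2 W.fst := by
    refine mul_left_cancel₀ hMinus ?_
    linear_combination -j3 - j4 + aPlus * s1
  have y1 : traceLeftL _ _ 1 2 W.fst - c * traceLeftL _ _ 0 1 W.fst = 0 := by
    refine (mul_eq_zero.mp ?_).resolve_left x1
    linear_combination -p1 + s4 - c * s3
  have y2 : traceLeftL _ _ 1 2 W.fst + c * traceLeftL _ _ 0 1 W.fst = 0 := by
    refine (mul_eq_zero.mp ?_).resolve_left x2
    linear_combination -p2 + s4 + c * s3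
  have v1 : traceLeftL _ _ 1 2 W.fst = 0 := by linear_combination (y1 + y2) / 2
  have v0 : traceLeftL _ _ 0 1 W.fst = 0 := by
    refine (mul_eq_zero.mp ?_).resolve_left hc
    linear_combination (y2 - y1) / 2
  have w0 : traceLeftL _ _ 0 1 W.snd = 0 := by linear_combination -j1 + s3 - v0
  have w1 : traceLeftL _ _ 1 2 W.snd = 0 := by
    refine (mul_eq_zero.mp ?_).resolve_left hPlus
    linear_combination j4 + aMinus * s4 - aMinus * v1
  refine (isInvertible_fullSymbol_prod_cauchyData hMinus hPlus (2 / 3)).injective ?_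
  rw [map_zero, ContinuousLinearMap.prod_apply, hW, (cauchyData_eq_iff W 0).mpr ⟨⟨v0, v1⟩, w0, w1⟩]
  rfl

instance (aMinus aPlus : ℂ) : CompleteSpace (EHat aMinus aPlus) := by
  have h : IsClosed (EHatSubmodule aMinus aPlus : Set H2Pieces) := by
    have h1 : (EHatSubmodule aMinus aPlus : Set H2Pieces) = jumps aMinus aPlus ⁻¹' {0} :=
      Set.ext fun W => mem_EHatSubmodule_iff aMinus aPlus W
    rw [h1]
    exact isClosed_singleton.preimage (jumps aMinus aPlus).continuous
  exact h.completeSpace_coe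

lemma analyticAt_sq_smul_add {X H : Type*} [NormedAddCommGroup X] [NormedSpace ℂ X]
    [NormedAddCommGroup H] [NormedSpace ℂ H] (P Q : X →L[ℂ] H) (z₀ : ℂ) :
    AnalyticAt ℂ (fun z : ℂ => z ^ 2 • P + Q) z₀ :=
  ((analyticAt_id.pow 2).smul analyticAt_const).add analyticAt_const

lemma analyticAt_fullSymbol (aMinus aPlus z₀ : ℂ) :
    AnalyticAt ℂ (fullSymbol aMinus aPlus) z₀ :=
  analyticAt_sq_smul_add _ _ z₀

lemma analyticAt_symbol (aMinus aPlus z₀ : ℂ) : AnalyticAt ℂ (symbol aMinus aPlus) z₀ :=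
  (analyticAt_fullSymbol aMinus aPlus z₀).clm_comp analyticAt_const

lemma isInvertible_symbol_iff {aMinus aPlus z : ℂ} :
    (symbol aMinus aPlus z).IsInvertible ↔ z ∉ symbolSpectrum aMinus aPlus := by
  rw [symbolSpectrum, Set.mem_ofPred_eq, not_not]
  exact ⟨fun h => h.bijective, isInvertible_of_bijective⟩

lemma eventually_bijective_symbol_and_hasFiniteRankPolarPartAt {aMinus aPlus : ℂ}
    (hMinus : aMinus ≠ 0) (hPlus : aPlus ≠ 0) (z₀ : ℂ) :
    (∀ᶠ z in 𝓝[≠] z₀, Function.Bijective (symbol aMinus aPlus z)) ∧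
      HasFiniteRankPolarPartAt (symbolInverse aMinus aPlus) z₀ :=
  eventually_bijective_and_hasFiniteRankPolarPartAt (analyticAt_fullSymbol aMinus aPlus)
    (isInvertible_fullSymbol_prod_cauchyData hMinus hPlus) (mem_EHatSubmodule_iff aMinus aPlus)
    (fun _ => eq_zero_of_fullSymbol_two_thirds hMinus hPlus) z₀

end MellinTransmission

end

theorem mainTheorem4 (aMinus aPlus : ℂ) (hMinus : aMinus ≠ 0) (hPlus : aPlus ≠ 0) :
    (∀ z ∉ MellinTransmission.symbolSpectrum aMinus aPlus,
      (MellinTransmission.symbol aMinus aPlus z).IsInvertible) ∧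
    (∀ z₀ : ℂ, ∀ᶠ z in 𝓝[≠] z₀, z ∉ MellinTransmission.symbolSpectrum aMinus aPlus) ∧
    AnalyticOnNhd ℂ (MellinTransmission.symbolInverse aMinus aPlus)
      (MellinTransmission.symbolSpectrum aMinus aPlus)ᶜ ∧
    MeromorphicOn (MellinTransmission.symbolInverse aMinus aPlus) univ ∧
    (∀ z₀ : ℂ, MellinTransmission.HasFiniteRankPolarPartAt
      (MellinTransmission.symbolInverse aMinus aPlus) z₀) ∧
    {z₀ : ℂ | meromorphicOrderAt (MellinTransmission.symbolInverse aMinus aPlus) z₀ < 0} =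
      MellinTransmission.symbolSpectrum aMinus aPlus := by
  have h := MellinTransmission.eventually_bijective_symbol_and_hasFiniteRankPolarPartAt hMinus hPlus
  have hinv : ∀ z₀, ∀ᶠ z in 𝓝[≠] z₀, (MellinTransmission.symbol aMinus aPlus z).IsInvertible :=
    fun z₀ => (h z₀).1.mono fun z => MellinTransmission.isInvertible_of_bijective
  refine ⟨fun z => MellinTransmission.isInvertible_symbol_iff.mpr,
    fun z₀ => (hinv z₀).mono fun z => MellinTransmission.isInvertible_symbol_iff.mp,
    fun z hz => MellinTransmission.analyticAt_inverse
      (MellinTransmission.analyticAt_symbol aMinus aPlus z)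
      (MellinTransmission.isInvertible_symbol_iff.mpr hz),
    fun z₀ _ => (h z₀).2.meromorphicAt, fun z₀ => (h z₀).2, Set.ext fun z₀ => ?_⟩
  refine (MellinTransmission.meromorphicOrderAt_inverse_neg_iff
    (MellinTransmission.analyticAt_symbol aMinus aPlus z₀) (hinv z₀)
    (h z₀).2.meromorphicAt).trans ?_
  rw [MellinTransmission.isInvertible_symbol_iff, not_not]
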